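/- Let $a\in\mathbb R\setminus\{-1,2,3\}$, and consider the Picard–Fuchs system for $J=(J_{-1},J_0,J_1)^\top$, with $'=d/dt$: $$\begin{array}{l} tJ_{-1}'+(4-2a)J_0'+(a-1)J_1'=\frac13J_{-1},\\ (1-a)tJ_{-1}'+2atJ_0'+(3+2a-a^2)J_1'=\frac43aJ_0,\\ (a-2)tJ_{-1}'+(2-2a)tJ_0'+atJ_1'=\frac32(1-a)J_0+aJ_1. \end{array}\tag{1}$$ Then there are $r>0$ and a vector power series $Q$ with real coefficients, convergent for $|t|<r$, which solves (1) in the complex disc $|t|<r$ and has the form $$Q(t)=\begin{pmatrix}1\\0\\0\end{pmatrix}-\begin{pmatrix}\frac{a-1}{12(a-2)^2}\\ \frac1{6(a-2)}\\0\end{pmatrix}t-\begin{pmatrix}\frac{11a^2-22a+15}{576(a-2)^4}\\ \frac{a-1}{48(a-2)^3}\\ \frac1{72(a-2)^2}\end{pmatrix}t^2-\begin{pmatrix}\frac{35(a-1)(5a^2-10a+9)}{20736(a-2)^6}\\ \frac{85a^2-170a+105}{10368(a-2)^5}\\ \frac{5(a-1)}{864(a-2)^4}\end{pmatrix}t^3+\cdots,$$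 such that the following two statements hold. (i) If $a\ne0$, there is a vector power series $S$ with real coefficients, convergent for $|t|<r$, such that, with $$P(t)=\begin{pmatrix}3(a-1)\\ \frac{3(3+2a-a^2)}{4a}\\ \frac{9(a-1)(3+2a-a^2)}{8a^2}\end{pmatrix}+\begin{pmatrix}0\\0\\1\end{pmatrix}t ,$$ the functions $P(t)$, $Q(t)$, $R(t)=Q(t)\ln t+S(t)$ form a fundamental system of solutions of (1) (each is a solution, and every solution is a linear combination of them in exactly one way) on each of the real intervals $(-r,0)$ and $(0,r)$, where $\ln t$ is read as $\ln|t|$, and also on every domain $U\subset\{t\in\mathbb C:0<|t|<r\}$ on which a branch of $\ln t$ exists, for every such branch. (ii) Let $-1<a<2$ and $H(x,y)=x\,[\,y^2+ax^2-3(a-1)x+3(a-2)\,]$. For every $t\in(-r,0)$ the level curve $\{H=t\}$ contains an oval $\delta(t)$ surrounding the center $(1,0)$. There is a vector power series $D(t)=(D_{-1},D_0,D_1)^\top$ with real coefficients, convergent for $|t|<r$, such that for all $t\in(-r,0)$ and $k=-1,0,1$ the integrals $J_k(t)=\int_{\delta(t)}x^ky\,dx$, with $\delta(t)$ oriented along the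 Hamiltonian vector field $(H_y,-H_x)$, satisfy $$J_k(t)=-2\sqrt{3(2-a)}\;Q_k(t)\ln|t|+D_k(t),$$ where $Q=(Q_{-1},Q_0,Q_1)^\top$. -/

import Mathlib

open Set

noncomputable section

/-- The cubic Hamiltonian `H(x,y) = x (y² + a x² - 3(a-1) x + 3(a-2))`. -/
def hamH (a x y : ℝ) : ℝ := x * (y ^ 2 + a * x ^ 2 - 3 * (a - 1) * x + 3 * (a - 2))

/-- The Hamiltonian vector field `(H_y, -H_x)`. -/
def hamField (a : ℝ) (p : ℝ × ℝ) : ℝ × ℝ :=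
  (deriv (fun y => hamH a p.1 y) p.2, -deriv (fun x => hamH a x p.2) p.1)

/-- `γ` is a `C¹` simple closed parametrization (of period `1`) of an oval of the level curve
`H = t` that surrounds the center `(1,0)`, oriented along the Hamiltonian vector field.
"Surrounds": the center lies off the oval, in a bounded component of its complement. -/
structure IsOval (a t : ℝ) (γ : ℝ → ℝ × ℝ) : Prop where
  contDiff : ContDiff ℝ 1 γ
  periodic : Function.Periodic γ 1
  injOn : InjOn γ (Ico 0 1)
  level : ∀ s, hamH a (γ s).1 (γ s).2 = t
  oriented : ∀ s, ∃ ρ : ℝ, 0 < ρ ∧ deriv γ s = ρ • hamField a (γ s)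
  center_notMem : ((1, 0) : ℝ × ℝ) ∉ range γ
  surrounds : Bornology.IsBounded (connectedComponentIn (range γ)ᶜ ((1, 0) : ℝ × ℝ))

/-- The line integral `∮ x^k y dx` along the closed curve `γ` (of period `1`). -/
def ovalIntegral (γ : ℝ → ℝ × ℝ) (k : ℤ) : ℝ :=
  ∫ s in (0 : ℝ)..1, (γ s).1 ^ k * (γ s).2 * (deriv γ s).1

/-- `J` is a differentiable solution of the Picard–Fuchs system on the (open) set `U`, in the
real (`𝕜 = ℝ`) or complex (`𝕜 = ℂ`) variable `t`.
The components `J t 0, J t 1, J t 2` stand for `J_{-1}(t), J_0(t), J_1(t)`. -/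
def IsPFSolution {𝕜 : Type} [RCLike 𝕜] (a : ℝ) (U : Set 𝕜) (J : 𝕜 → Fin 3 → 𝕜) : Prop :=
  ∀ t ∈ U, DifferentiableAt 𝕜 J t ∧
    t * deriv J t 0 + (4 - 2 * (a : 𝕜)) * deriv J t 1 + ((a : 𝕜) - 1) * deriv J t 2
      = 1 / 3 * J t 0 ∧
    (1 - (a : 𝕜)) * t * deriv J t 0 + 2 * (a : 𝕜) * t * deriv J t 1
        + (3 + 2 * (a : 𝕜) - (a : 𝕜) ^ 2) * deriv J t 2
      = 4 / 3 * (a : 𝕜) * J t 1 ∧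
    ((a : 𝕜) - 2) * t * deriv J t 0 + (2 - 2 * (a : 𝕜)) * t * deriv J t 1
        + (a : 𝕜) * t * deriv J t 2
      = 3 / 2 * (1 - (a : 𝕜)) * J t 1 + (a : 𝕜) * J t 2

/-- `F 0, F 1, F 2` is a fundamental system of solutions of the Picard–Fuchs system on `U`:
each is a solution, and every solution is a linear combination of them in exactly one way. -/
def IsPFFundamental {𝕜 : Type} [RCLike 𝕜] (a : ℝ) (U : Set 𝕜)
    (F : Fin 3 → 𝕜 → Fin 3 → 𝕜) : Prop :=
  (∀ k, IsPFSolution a U (F k)) ∧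
    ∀ J : 𝕜 → Fin 3 → 𝕜, IsPFSolution a U J →
      ∃! c : Fin 3 → 𝕜, ∀ t ∈ U, J t = ∑ k, c k • F k t

/-- The vector power series with real coefficients `c` converges for `|t| < r`. (For real series
summability is absolute, so this also gives convergence in the complex disc of radius `r`.) -/
def VecSeriesConverges (c : ℕ → Fin 3 → ℝ) (r : ℝ) : Prop :=
  ∀ i, ∀ x : ℝ, |x| < r → Summable fun n => c n i * x ^ n

/-- The sum `∑ cₙ tⁿ` of a vector power series with real coefficients, at real or complex `t`. -/
def vecSeries {𝕜 : Type} [RCLike 𝕜] (c : ℕ → Fin 3 → ℝ) (t : 𝕜) : Fin 3 → 𝕜 :=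
  fun i => ∑' n, (c n i : 𝕜) * t ^ n

/-- The linear vector polynomial `P(t)`. -/
def linP {𝕜 : Type} [RCLike 𝕜] (a : ℝ) (t : 𝕜) : Fin 3 → 𝕜 :=
  ![3 * ((a : 𝕜) - 1),
    3 * (3 + 2 * (a : 𝕜) - (a : 𝕜) ^ 2) / (4 * (a : 𝕜)),
    9 * ((a : 𝕜) - 1) * (3 + 2 * (a : 𝕜) - (a : 𝕜) ^ 2) / (8 * (a : 𝕜) ^ 2) + t]

/-- The triple `P(t)`, `Q(t)`, `Q(t) ℓ(t) + S(t)`, where `Q`, `S` have the coefficients `q`, `s`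
and `ℓ` is a determination of the logarithm. -/
def logSystem {𝕜 : Type} [RCLike 𝕜] (a : ℝ) (q s : ℕ → Fin 3 → ℝ) (l : 𝕜 → 𝕜) :
    Fin 3 → 𝕜 → Fin 3 → 𝕜 :=
  ![linP a, vecSeries q, fun t => l t • vecSeries q t + vecSeries s t]

end

/-! Write the system as `(A₀ + t A₁) J' = B J`. The last row of `A₀` vanishes, so the first two
equations at order `tⁿ` and the last one at order `tⁿ⁺¹` form a recursion for the coefficients of a
power series solution. The determinant `-2 (a - 2)² (3 + 2 a - a²)` of its matrix does not depend on
`n`, hence the coefficients grow at most geometrically. This gives `Q`, and also `S`, from the same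
recursion with the forcing terms produced by `Q ln t`. The Wronskian of `P`, `Q`, `Q ln t + S` does
not contain the logarithm and is nonzero at `0`, while the system is regular for small `t ≠ 0`.

In the coordinates `u = (x - 1) √(a (x - 1) + 3)`, `w = √x y` the ovals are the circles
`u² + w² = t + 3 - a`, and the Hamiltonian flow turns them clockwise. The integrals `J_k` thereby
become trigonometric integrals with fixed limits, which can be differentiated under the integral
sign and satisfy the system. In the resulting expansion of `J` at `t = 0` the coefficient of the
logarithm is read off from the last right-hand side `3/2 (1 - a) J₀ + a J₁`: it tends to `0` on `P`
and `Q` and to `a - 2` on `Q ln t + S`, while its limit on `J` is an elementary integral over the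
critical level curve. -/

noncomputable section

open Filter Topology Matrix
open scoped Real

section LinearSystem

variable {𝕜 ι : Type*} [RCLike 𝕜] [Fintype ι] [DecidableEq ι]

theorem differentiableAt_det {M : 𝕜 → Matrix ι ι 𝕜} {t : 𝕜}
    (hM : ∀ i, DifferentiableAt 𝕜 (fun s => M s i) t) :
    DifferentiableAt 𝕜 (fun s => (M s).det) t := by
  simp only [det_apply]
  exact .fun_sum fun σ _ => .fun_const_smul
    (.fun_finsetProd fun i _ => differentiableAt_pi.1 (hM (σ i)) i) _

theorem differentiableAt_vecMul_inv {M : 𝕜 → Matrix ι ι 𝕜} {v : 𝕜 → ι → 𝕜} {t : 𝕜}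
    (hM : ∀ i, DifferentiableAt 𝕜 (fun s => M s i) t) (hv : DifferentiableAt 𝕜 v t)
    (hdet : (M t).det ≠ 0) : DifferentiableAt 𝕜 (fun s => v s ᵥ* (M s)⁻¹) t := by
  have hadj : ∀ i j, DifferentiableAt 𝕜 (fun s => (M s).adjugate i j) t := fun i j => by
    simp only [adjugate_apply]
    refine differentiableAt_det fun k => ?_
    obtain rfl | hk := eq_or_ne k j
    · simp only [updateRow_self, differentiableAt_const]
    · simpa only [updateRow_ne hk] using hM k
  refine differentiableAt_pi.2 fun j => ?_
  simp only [vecMul, dotProduct, inv_def, Ring.inverse_eq_inv', Matrix.smul_apply]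
  exact .fun_sum fun i _ => (differentiableAt_pi.1 hv i).mul
    (((differentiableAt_det hM).inv hdet).mul (hadj i j))

/-- `J` is a differentiable solution on `U` of the implicit linear system `A(t) J' = B(t) J`. -/
def IsLinearSystemSolution (A B : 𝕜 → Matrix ι ι 𝕜) (U : Set 𝕜) (J : 𝕜 → ι → 𝕜) : Prop :=
  ∀ t ∈ U, DifferentiableAt 𝕜 J t ∧ A t *ᵥ deriv J t = B t *ᵥ J t

variable {A B : 𝕜 → Matrix ι ι 𝕜} {U : Set 𝕜} {F : ι → 𝕜 → ι → 𝕜} {J c : 𝕜 → ι → 𝕜} {t : 𝕜}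

theorem IsLinearSystemSolution.deriv_coeff_eq_zero (hU : IsOpen U)
    (hF : ∀ k, IsLinearSystemSolution A B U (F k)) (hJ : IsLinearSystemSolution A B U J)
    (hJc : ∀ s ∈ U, J s = ∑ k, c s k • F k s) (ht : t ∈ U) (hA : (A t).det ≠ 0)
    (hdet : (of fun k => F k t).det ≠ 0) (hc : DifferentiableAt 𝕜 c t) : deriv c t = 0 := by
  have hderiv : deriv J t = ∑ k, (c t k • deriv (F k) t + deriv c t k • F k t) :=
    ((HasDerivAt.fun_sum fun k _ => (hasDerivAt_pi.1 hc.hasDerivAt k).smul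
      (hF k t ht).1.hasDerivAt).congr_of_eventuallyEq
        (eventually_of_mem (hU.mem_nhds ht) hJc)).deriv
  have hAc : A t *ᵥ ∑ k, deriv c t k • F k t = 0 := by
    have h := (hJ t ht).2
    simpa only [hderiv, hJc t ht, Finset.sum_add_distrib, mulVec_add, mulVec_sum, mulVec_smul,
      (hF _ t ht).2, add_eq_left] using h
  exact eq_zero_of_vecMul_eq_zero hdet
    ((vecMul_eq_sum _ _).trans (eq_zero_of_mulVec_eq_zero hA hAc))

theorem IsLinearSystemSolution.existsUnique_eq_sum_smul (hU : IsOpen U) (hUc : IsConnected U)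
    (hA : ∀ t ∈ U, (A t).det ≠ 0) (hF : ∀ k, IsLinearSystemSolution A B U (F k))
    (hdet : ∀ t ∈ U, (of fun k => F k t).det ≠ 0) (hJ : IsLinearSystemSolution A B U J) :
    ∃! c : ι → 𝕜, ∀ t ∈ U, J t = ∑ k, c k • F k t := by
  have hsum : ∀ t (x : ι → 𝕜), ∑ k, x k • F k t = x ᵥ* of fun k => F k t := fun t x =>
    (vecMul_eq_sum x _).symm
  obtain ⟨t₀, ht₀⟩ := hUc.nonempty
  set c : 𝕜 → ι → 𝕜 := fun t => J t ᵥ* (of fun k => F k t)⁻¹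
  have hJc : ∀ t ∈ U, J t = ∑ k, c t k • F k t := fun t ht => by
    rw [hsum, vecMul_vecMul, nonsing_inv_mul _ (hdet t ht).isUnit, vecMul_one]
  have hc : ∀ t ∈ U, DifferentiableAt 𝕜 c t := fun t ht =>
    differentiableAt_vecMul_inv (fun k => (hF k t ht).1) (hJ t ht).1 (hdet t ht)
  have hconst : ∀ t ∈ U, c t = c t₀ := fun t ht =>
    hU.is_const_of_deriv_eq_zero hUc.isPreconnected
      (fun s hs => (hc s hs).differentiableWithinAt)
      (fun s hs => deriv_coeff_eq_zero hU hF hJ hJc hs (hA s hs) (hdet s hs) (hc s hs)) ht ht₀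
  refine ⟨c t₀, fun t ht => hconst t ht ▸ hJc t ht, fun c' hc' => ?_⟩
  have h := (hc' t₀ ht₀).symm.trans (hJc t₀ ht₀)
  rw [hsum, hsum] at h
  exact vecMul_injective_of_isUnit ((isUnit_iff_isUnit_det _).2 (hdet t₀ ht₀).isUnit) h

end LinearSystem

section VecSeries

variable {𝕜 : Type} [RCLike 𝕜] {c d : ℕ → Fin 3 → ℝ} {r : ℝ} {t : 𝕜}

/-- The coefficients of the termwise derivative of a vector power series. -/
def derivCoeff (c : ℕ → Fin 3 → ℝ) : ℕ → Fin 3 → ℝ := fun n => (n + 1 : ℝ) • c (n + 1)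

theorem exists_vecSeriesConverges_of_geometric {A C : ℝ} (hc : ∀ n, ‖c n‖ ≤ A ^ n * C) :
    ∃ r > 0, VecSeriesConverges c r := by
  refine ⟨(|A| + 1)⁻¹, by positivity, fun i x hx => ?_⟩
  have hAx : |A * x| < 1 := by
    rw [abs_mul]
    have := (lt_inv_mul_iff₀ (by positivity)).1 (hx.trans_eq (mul_one _).symm)
    nlinarith [abs_nonneg x]
  refine Summable.of_norm_bounded
    ((summable_geometric_of_lt_one (abs_nonneg _) hAx).mul_right |C|) fun n => ?_
  calc ‖c n i * x ^ n‖ ≤ |A ^ n * C| * |x| ^ n := by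
        rw [norm_mul, norm_pow]
        gcongr
        exacts [(norm_le_pi_norm _ i).trans ((hc n).trans (le_abs_self _)), le_rfl]
    _ = |A * x| ^ n * |C| := by rw [abs_mul, abs_mul, abs_pow]; ring

theorem VecSeriesConverges.mono {r' : ℝ} (hc : VecSeriesConverges c r) (hr : r' ≤ r) :
    VecSeriesConverges c r' :=
  fun i x hx => hc i x (hx.trans_le hr)

theorem VecSeriesConverges.add (hc : VecSeriesConverges c r) (hd : VecSeriesConverges d r) :
    VecSeriesConverges (c + d) r := fun i x hx => by
  simpa only [Pi.add_apply, add_mul] using (hc i x hx).add (hd i x hx)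

theorem VecSeriesConverges.summable_norm (hc : VecSeriesConverges c r) {ρ : ℝ} (hρ : |ρ| < r)
    (i : Fin 3) : Summable fun n => ‖c n i‖ * |ρ| ^ n := by
  simpa only [norm_mul, norm_pow, Real.norm_eq_abs] using (hc i ρ hρ).norm

theorem VecSeriesConverges.hasSum (hc : VecSeriesConverges c r) (ht : ‖t‖ < r) (i : Fin 3) :
    HasSum (fun n => (c n i : 𝕜) * t ^ n) (vecSeries c t i) := by
  refine Summable.hasSum (.of_norm ?_)
  simpa only [norm_mul, norm_pow, RCLike.norm_ofReal, abs_norm, Real.norm_eq_abs] using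
    hc.summable_norm (ρ := ‖t‖) (by rwa [abs_norm]) i

theorem VecSeriesConverges.deriv (hc : VecSeriesConverges c r) :
    VecSeriesConverges (derivCoeff c) r := fun i x hx => by
  obtain ⟨ρ, hxρ, hρr⟩ := exists_between hx
  have hρ : 0 < ρ := (abs_nonneg x).trans_lt hxρ
  have hbdd : (fun n : ℕ => (n + 1 : ℝ) * (c (n + 1) i * ρ ^ n)) =O[atTop]
      fun n => ((n ^ 1 : ℕ) : ℝ) := by
    have hterm : (fun n : ℕ => c (n + 1) i * ρ ^ (n + 1)) =O[atTop] fun _ => (1 : ℝ) :=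
      ((hc i ρ (by rwa [abs_of_pos hρ])).tendsto_atTop_zero.comp
        (tendsto_add_atTop_nat 1)).isBigO_one ℝ
    have hlin : (fun n : ℕ => (n + 1 : ℝ)) =O[atTop] fun n => ((n ^ 1 : ℕ) : ℝ) :=
      .of_bound 2 <| (eventually_ge_atTop 1).mono fun n hn => by
        have : (1 : ℝ) ≤ n := by exact_mod_cast hn
        rw [pow_one, Real.norm_of_nonneg (by positivity), Real.norm_of_nonneg (by positivity)]
        linarith
    refine ((hlin.mul hterm).const_mul_left ρ⁻¹).congr (fun n => ?_) fun n => mul_one _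
    field_simp
    ring
  have hxρ' : ‖x / ρ‖ < 1 := by
    rwa [norm_div, Real.norm_eq_abs, Real.norm_of_nonneg hρ.le, div_lt_one hρ]
  refine (summable_norm_mul_geometric_of_norm_lt_one' hxρ' hbdd).of_norm.congr fun n => ?_
  rw [derivCoeff, Pi.smul_apply, smul_eq_mul, div_pow]
  field_simp

theorem VecSeriesConverges.hasDerivAt (hc : VecSeriesConverges c r) (ht : ‖t‖ < r) :
    HasDerivAt (vecSeries c : 𝕜 → Fin 3 → 𝕜) (vecSeries (derivCoeff c) t) t := by
  obtain ⟨ρ, htρ, hρr⟩ := exists_between ht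
  have hρ : 0 < ρ := (norm_nonneg t).trans_lt htρ
  refine hasDerivAt_pi.2 fun i => ?_
  have htail : HasDerivAt (fun z : 𝕜 => ∑' n, (c (n + 1) i : 𝕜) * z ^ (n + 1))
      (vecSeries (derivCoeff c) t i) t := by
    refine hasDerivAt_tsum_of_isPreconnected (t := Metric.ball (0 : 𝕜) ρ) (y₀ := 0)
      (g' := fun n y => (derivCoeff c n i : 𝕜) * y ^ n)
      (hc.deriv.summable_norm (by rwa [abs_of_pos hρ]) i) Metric.isOpen_ball
      (convex_ball _ _).isPreconnected (fun n y _ => ?_) (fun n y hy => ?_)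
      (Metric.mem_ball_self hρ) (by simp [summable_zero]) (by simpa using htρ)
    · refine ((hasDerivAt_pow (n + 1) y).const_mul (c (n + 1) i : 𝕜)).congr_deriv ?_
      simp only [derivCoeff, add_tsub_cancel_right, Pi.smul_apply, smul_eq_mul]
      push_cast
      ring
    · rw [norm_mul, norm_pow, RCLike.norm_ofReal, abs_of_pos hρ, Real.norm_eq_abs]
      gcongr
      exact (mem_ball_zero_iff.1 hy).le
  refine (htail.const_add (c 0 i : 𝕜)).congr_of_eventuallyEq ?_
  filter_upwards [Metric.isOpen_ball.mem_nhds (mem_ball_zero_iff.2 ht)] with z hz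
  simpa [vecSeries] using (hc.hasSum (mem_ball_zero_iff.1 hz) i).summable.tsum_eq_zero_add

theorem vecSeries_zero (c : ℕ → Fin 3 → ℝ) : vecSeries c (0 : 𝕜) = fun i => (c 0 i : 𝕜) := by
  ext i
  rw [vecSeries, tsum_eq_single 0 fun n hn => by rw [zero_pow hn, mul_zero], pow_zero, mul_one]

theorem vecSeries_add (hc : VecSeriesConverges c r) (hd : VecSeriesConverges d r) (ht : ‖t‖ < r) :
    vecSeries (c + d) t = vecSeries c t + vecSeries d t := by
  ext i
  refine HasSum.tsum_eq ?_
  simpa only [Pi.add_apply, RCLike.ofReal_add, add_mul] using (hc.hasSum ht i).add (hd.hasSum ht i)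

theorem VecSeriesConverges.const_smul (hc : VecSeriesConverges c r) (k : ℝ) :
    VecSeriesConverges (k • c) r := fun i x hx => by
  simpa only [Pi.smul_apply, smul_eq_mul, mul_assoc] using (hc i x hx).mul_left k

theorem vecSeries_const_smul (c : ℕ → Fin 3 → ℝ) (k : ℝ) (t : 𝕜) :
    vecSeries (k • c) t = (k : 𝕜) • vecSeries c t := by
  ext i
  simp only [vecSeries, Pi.smul_apply, smul_eq_mul, RCLike.ofReal_mul, mul_assoc, tsum_mul_left]

theorem VecSeriesConverges.const_mulVec (hc : VecSeriesConverges c r)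
    (M : Matrix (Fin 3) (Fin 3) ℝ) : VecSeriesConverges (fun n => M *ᵥ c n) r := fun i x hx => by
  simp only [mulVec, dotProduct, Finset.sum_mul, mul_assoc]
  exact summable_sum fun j _ => (hc j x hx).mul_left (M i j)

theorem vecSeries_mulVec (hc : VecSeriesConverges c r) (M : Matrix (Fin 3) (Fin 3) ℝ)
    (ht : ‖t‖ < r) :
    vecSeries (fun n => M *ᵥ c n) t = M.map (algebraMap ℝ 𝕜) *ᵥ vecSeries c t := by
  ext i
  refine HasSum.tsum_eq ?_
  simpa only [mulVec, dotProduct, map_apply, RCLike.algebraMap_eq_ofReal, RCLike.ofReal_sum,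
    RCLike.ofReal_mul, Finset.sum_mul, mul_assoc] using
    hasSum_sum fun j _ => (hc.hasSum ht j).mul_left (M i j : 𝕜)

theorem VecSeriesConverges.shift (hc : VecSeriesConverges c r) :
    VecSeriesConverges (fun n => c (n + 1)) r := fun i x hx => by
  refine Summable.of_norm_bounded (hc.deriv i x hx).norm fun n => ?_
  rw [derivCoeff, Pi.smul_apply, smul_eq_mul, mul_assoc, norm_mul _ (_ * _)]
  refine le_mul_of_one_le_left (norm_nonneg (c (n + 1) i * x ^ n)) ?_
  rw [Real.norm_of_nonneg (by positivity)]
  exact le_add_of_nonneg_left n.cast_nonneg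

theorem vecSeries_eq_add_smul_shift (hc : VecSeriesConverges c r) (ht : ‖t‖ < r) :
    vecSeries c t = (fun i => (c 0 i : 𝕜)) + t • vecSeries (fun n => c (n + 1)) t := by
  ext i
  refine ((hasSum_nat_add_iff' 1).1 ?_).tsum_eq
  simpa [pow_succ', mul_left_comm] using (hc.shift.hasSum ht i).mul_left t

theorem hasSum_natCast_smul (hc : VecSeriesConverges c r) (ht : ‖t‖ < r) (i : Fin 3) :
    HasSum (fun n : ℕ => (((n : ℝ) • c n) i : 𝕜) * t ^ n) ((t • vecSeries (derivCoeff c) t) i) := by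
  rw [← hasSum_nat_add_iff' 1]
  simp only [Finset.range_one, Finset.sum_singleton, Nat.cast_zero, zero_smul, Pi.zero_apply,
    RCLike.ofReal_zero, zero_mul, sub_zero]
  refine ((hc.deriv.hasSum ht i).mul_left t).congr_fun fun n => ?_
  simp only [derivCoeff, Pi.smul_apply, smul_eq_mul]
  push_cast
  ring

theorem VecSeriesConverges.natCast_smul (hc : VecSeriesConverges c r) :
    VecSeriesConverges (fun n => (n : ℝ) • c n) r := fun i _ hx =>
  (hasSum_natCast_smul (𝕜 := ℝ) hc hx i).summable

theorem vecSeries_natCast_smul (hc : VecSeriesConverges c r) (ht : ‖t‖ < r) :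
    vecSeries (fun n => (n : ℝ) • c n) t = t • vecSeries (derivCoeff c) t :=
  funext fun i => (hasSum_natCast_smul hc ht i).tsum_eq

end VecSeries

section PicardFuchs

/-- The matrix `A₀` of the Picard–Fuchs system `(A₀ + t A₁) J' = B J`. -/
def pfConst {R : Type*} [CommRing R] (a : R) : Matrix (Fin 3) (Fin 3) R :=
  !![0, 4 - 2 * a, a - 1; 0, 0, 3 + 2 * a - a ^ 2; 0, 0, 0]

/-- The matrix `A₁` of the Picard–Fuchs system `(A₀ + t A₁) J' = B J`. -/
def pfLinear {R : Type*} [CommRing R] (a : R) : Matrix (Fin 3) (Fin 3) R :=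
  !![1, 0, 0; 1 - a, 2 * a, 0; a - 2, 2 - 2 * a, a]

/-- The matrix `B` of the Picard–Fuchs system `(A₀ + t A₁) J' = B J`. -/
def pfRhs {K : Type*} [Field K] (a : K) : Matrix (Fin 3) (Fin 3) K :=
  !![1 / 3, 0, 0; 0, 4 / 3 * a, 0; 0, 3 / 2 * (1 - a), a]

variable {𝕜 : Type} [RCLike 𝕜] {a : ℝ}

theorem pfConst_map {R S : Type*} [CommRing R] [CommRing S] (f : R →+* S) (a : R) :
    (pfConst a).map f = pfConst (f a) := by
  ext i j
  fin_cases i <;> fin_cases j <;> simp [pfConst, map_ofNat]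

theorem pfLinear_map {R S : Type*} [CommRing R] [CommRing S] (f : R →+* S) (a : R) :
    (pfLinear a).map f = pfLinear (f a) := by
  ext i j
  fin_cases i <;> fin_cases j <;> simp [pfLinear, map_ofNat]

theorem pfRhs_map {K L : Type*} [Field K] [Field L] (f : K →+* L) (a : K) :
    (pfRhs a).map f = pfRhs (f a) := by
  ext i j
  fin_cases i <;> fin_cases j <;> simp [pfRhs, map_ofNat]

theorem isPFSolution_iff {U : Set 𝕜} {J : 𝕜 → Fin 3 → 𝕜} :
    IsPFSolution a U J ↔ IsLinearSystemSolution
      (fun t => pfConst (a : 𝕜) + t • pfLinear (a : 𝕜)) (fun _ => pfRhs (a : 𝕜)) U J := by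
  refine forall₂_congr fun t _ => and_congr_right fun _ => ?_
  simp only [pfConst, pfLinear, pfRhs, funext_iff, Fin.forall_fin_succ, IsEmpty.forall_iff,
    and_true, mulVec, dotProduct, Fin.sum_univ_three, Matrix.add_apply, Matrix.smul_apply,
    smul_eq_mul, Fin.succ_zero_eq_one, Fin.succ_one_eq_two, of_apply, cons_val]
  refine and_congr ?_ (and_congr ?_ ?_) <;> exact Eq.congr (by ring) (by ring)

/-- The factors are those of the critical values `0`, `a - 3` and `(a + 1) (a - 2)² / a²` of `H`. -/
theorem det_pfConst_add_smul_pfLinear {R : Type*} [CommRing R] (a t : R) :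
    (pfConst a + t • pfLinear a).det =
      2 * t * (t + 3 - a) * (a ^ 2 * t - (a + 1) * (a - 2) ^ 2) := by
  simp only [det_fin_three, pfConst, pfLinear, Matrix.add_apply, Matrix.smul_apply, of_apply,
    cons_val, smul_eq_mul]
  ring

/-- The coefficient relations which say that `ℓ(t) ∑ eₙ tⁿ + ∑ cₙ tⁿ` is a solution, where `ℓ` is
a logarithm and `∑ eₙ tⁿ` is itself a solution. -/
def IsPFCoeff (a : ℝ) (e c : ℕ → Fin 3 → ℝ) : Prop :=
  ∀ n : ℕ, pfConst a *ᵥ ((n + 1 : ℝ) • c (n + 1) + e (n + 1)) +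
    pfLinear a *ᵥ ((n : ℝ) • c n + e n) = pfRhs a *ᵥ c n

section Solutions

variable {c x y z : ℕ → Fin 3 → ℝ} {r : ℝ} {t : 𝕜}

theorem pf_vecSeries_eq (hx : VecSeriesConverges x r) (hy : VecSeriesConverges y r)
    (hz : VecSeriesConverges z r)
    (h : ∀ n, pfConst a *ᵥ x n + pfLinear a *ᵥ y n = pfRhs a *ᵥ z n) (ht : ‖t‖ < r) :
    pfConst (a : 𝕜) *ᵥ vecSeries x t + pfLinear (a : 𝕜) *ᵥ vecSeries y t =
      pfRhs (a : 𝕜) *ᵥ vecSeries z t := by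
  rw [← RCLike.algebraMap_eq_ofReal, ← pfConst_map, ← pfLinear_map, ← pfRhs_map,
    ← vecSeries_mulVec hx _ ht, ← vecSeries_mulVec hy _ ht, ← vecSeries_mulVec hz _ ht,
    ← vecSeries_add (hx.const_mulVec _) (hy.const_mulVec _) ht]
  exact congrArg (vecSeries · t) (funext h)

theorem IsPFCoeff.pf_deriv (h : IsPFCoeff a 0 c) (hc : VecSeriesConverges c r) (ht : ‖t‖ < r) :
    (pfConst (a : 𝕜) + t • pfLinear (a : 𝕜)) *ᵥ vecSeries (derivCoeff c) t =
      pfRhs (a : 𝕜) *ᵥ vecSeries c t := by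
  rw [add_mulVec, smul_mulVec, ← mulVec_smul, ← vecSeries_natCast_smul hc ht]
  refine pf_vecSeries_eq hc.deriv hc.natCast_smul hc (fun n => ?_) ht
  simpa only [Pi.zero_apply, add_zero, derivCoeff] using h n

theorem IsPFCoeff.isPFSolution (h : IsPFCoeff a 0 c) (hc : VecSeriesConverges c r) :
    IsPFSolution a (Metric.ball (0 : 𝕜) r) (vecSeries c) := by
  refine isPFSolution_iff.2 fun t ht => ?_
  have ht' := mem_ball_zero_iff.1 ht
  have hderiv := hc.hasDerivAt ht'
  exact ⟨hderiv.differentiableAt, hderiv.deriv ▸ h.pf_deriv hc ht'⟩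

theorem IsPFCoeff.isPFSolution_log {q s : ℕ → Fin 3 → ℝ} (hq : IsPFCoeff a 0 q)
    (hs : IsPFCoeff a q s) (hq0 : pfConst a *ᵥ q 0 = 0) (hqr : VecSeriesConverges q r)
    (hsr : VecSeriesConverges s r) {U : Set 𝕜} {l : 𝕜 → 𝕜}
    (hU : ∀ t ∈ U, ‖t‖ < r ∧ t ≠ 0 ∧ HasDerivAt l t⁻¹ t) :
    IsPFSolution a U fun t => l t • vecSeries q t + vecSeries s t := by
  refine isPFSolution_iff.2 fun t ht => ?_
  obtain ⟨htr, ht0, hl⟩ := hU t ht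
  have hderiv := (hl.smul (hqr.hasDerivAt htr)).add (hsr.hasDerivAt htr)
  refine ⟨hderiv.differentiableAt, ?_⟩
  set y : ℕ → Fin 3 → ℝ := (fun n : ℕ => (n : ℝ) • s n) + q
  have hy : VecSeriesConverges y r := hsr.natCast_smul.add hqr
  have hy_sum : vecSeries y t = t • vecSeries (derivCoeff s) t + vecSeries q t := by
    rw [vecSeries_add hsr.natCast_smul hqr htr, vecSeries_natCast_smul hsr htr]
  have hy_shift : pfConst (a : 𝕜) *ᵥ vecSeries y t =
      t • pfConst (a : 𝕜) *ᵥ vecSeries (fun n => y (n + 1)) t := by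
    have hy0 : pfConst (a : 𝕜) *ᵥ (fun i => (y 0 i : 𝕜)) = 0 := by
      ext i
      have h := (RingHom.map_mulVec (algebraMap ℝ 𝕜) (pfConst a) (y 0) i).symm
      simpa only [y, Pi.add_apply, Nat.cast_zero, zero_smul, zero_add, hq0, Pi.zero_apply, map_zero,
        pfConst_map, Function.comp_def, RCLike.algebraMap_eq_ofReal] using h
    rw [vecSeries_eq_add_smul_shift hy htr, mulVec_add, hy0, zero_add, mulVec_smul]
  have hS : pfConst (a : 𝕜) *ᵥ vecSeries (fun n => y (n + 1)) t +
      pfLinear (a : 𝕜) *ᵥ vecSeries y t = pfRhs (a : 𝕜) *ᵥ vecSeries s t :=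
    pf_vecSeries_eq hy.shift hy hsr (fun n => by simpa [y] using hs n) htr
  have hJ : deriv (fun t => l t • vecSeries q t + vecSeries s t) t =
      l t • vecSeries (derivCoeff q) t + t⁻¹ • vecSeries y t := by
    rw [hy_sum, smul_add, inv_smul_smul₀ ht0, add_comm (vecSeries _ t), ← add_assoc]
    exact hderiv.deriv
  simp only [hJ, mulVec_add, mulVec_smul, hq.pf_deriv hqr htr, ← hS, add_right_inj]
  rw [add_mulVec, smul_mulVec, hy_shift, ← smul_add, inv_smul_smul₀ ht0]

end Solutions

section Recursion

theorem exists_norm_le_mul_norm_of_homogeneous {X E F : Type*} [TopologicalSpace X]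
    [NormedAddCommGroup E] [NormedSpace ℝ E] [FiniteDimensional ℝ E] [NormedAddCommGroup F]
    [NormedSpace ℝ F] {K : Set X} (hK : IsCompact K) {f : X → E → F}
    (hf : Continuous fun p : X × E => f p.1 p.2)
    (hsmul : ∀ x (k : ℝ) v, f x (k • v) = k • f x v) :
    ∃ A, 0 ≤ A ∧ ∀ x ∈ K, ∀ v, ‖f x v‖ ≤ A * ‖v‖ := by
  have : ProperSpace E := FiniteDimensional.proper_real E
  obtain ⟨A, hA⟩ :=
    (hK.prod (isCompact_sphere (0 : E) 1)).exists_bound_of_continuousOn hf.continuousOn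
  refine ⟨|A|, abs_nonneg A, fun x hx v => ?_⟩
  obtain rfl | hv := eq_or_ne v 0
  · simpa using congrArg norm (hsmul x 0 0)
  have hunit := hA (x, ‖v‖⁻¹ • v) ⟨hx, by simp [norm_smul, hv]⟩
  calc ‖f x v‖ = ‖f x (‖v‖ • ‖v‖⁻¹ • v)‖ := by rw [smul_inv_smul₀ (norm_ne_zero_iff.2 hv)]
    _ = ‖f x (‖v‖⁻¹ • v)‖ * ‖v‖ := by rw [hsmul, norm_smul, norm_norm, mul_comm]
    _ ≤ |A| * ‖v‖ := by gcongr; exact hunit.trans (le_abs_self A)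

theorem exists_geometric_of_le_mul_max {u v : ℕ → ℝ} {A K C : ℝ} (hA : 0 ≤ A)
    (hv : ∀ n, v n ≤ K ^ n * C) (hu : ∀ n, u (n + 1) ≤ A * max (u n) (max (v n) (v (n + 1)))) :
    ∃ K' C', ∀ n, u n ≤ K' ^ n * C' := by
  obtain ⟨L, hL, hKL⟩ : ∃ L, 1 ≤ L ∧ |K| ≤ L := ⟨_, le_max_left 1 |K|, le_max_right _ _⟩
  obtain ⟨D, hD, hCD, huD⟩ : ∃ D, 0 ≤ D ∧ |C| ≤ D ∧ u 0 ≤ D :=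
    ⟨max |C| (u 0), (abs_nonneg C).trans (le_max_left _ _), le_max_left _ _, le_max_right _ _⟩
  have hv' : ∀ n, v n ≤ L ^ n * D := fun n => calc
    v n ≤ |K ^ n * C| := (hv n).trans (le_abs_self _)
    _ = |K| ^ n * |C| := by rw [abs_mul, abs_pow]
    _ ≤ L ^ n * D := by gcongr
  have hLpow : ∀ n, L ^ n * D ≤ ((A + 1) * L) ^ n * D := fun n => by
    gcongr
    exact le_mul_of_one_le_left (by positivity) (by linarith)
  refine ⟨(A + 1) * L, D, fun n => ?_⟩
  induction n with
  | zero => simpa using huD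
  | succ n ih =>
    set w := ((A + 1) * L) ^ n * D with hw_def
    have hw : w ≤ L * w := le_mul_of_one_le_left (by positivity) hL
    have hvw : v (n + 1) ≤ L * w := calc
      v (n + 1) ≤ L * (L ^ n * D) := (hv' (n + 1)).trans_eq (by ring)
      _ ≤ L * w := mul_le_mul_of_nonneg_left (hLpow n) (by positivity)
    calc u (n + 1) ≤ A * max (u n) (max (v n) (v (n + 1))) := hu n
      _ ≤ A * (L * w) := by
        gcongr
        exact max_le (ih.trans hw) (max_le (((hv' n).trans (hLpow n)).trans hw) hvw)
      _ ≤ (A + 1) * (L * w) := mul_le_mul_of_nonneg_right (by linarith) (by positivity)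
      _ = ((A + 1) * L) ^ (n + 1) * D := by rw [hw_def]; ring

/-- The matrix of the recursion for the coefficients: the first two rows are those of `A₀` and the
last one is that of `A₁ - h B`, where `h = 1 / (n + 1)`. -/
def pfStepMatrix (a h : ℝ) : Matrix (Fin 3) (Fin 3) ℝ :=
  !![0, 4 - 2 * a, a - 1;
    0, 0, 3 + 2 * a - a ^ 2;
    a - 2, 2 - 2 * a - 3 / 2 * (1 - a) * h, a - a * h]

/-- The right-hand side of the recursion for the coefficients, in terms of `c = cₙ`, `e = eₙ` and
`e' = eₙ₊₁`; here `h = 1 / (n + 1)`. -/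
def pfStepRhs (a h : ℝ) (c e e' : Fin 3 → ℝ) : Fin 3 → ℝ :=
  let v := (h • pfRhs a - (1 - h) • pfLinear a) *ᵥ c - h • (pfLinear a *ᵥ e + pfConst a *ᵥ e')
  ![v 0, v 1, -(h * (pfLinear a *ᵥ e') 2)]

/-- The coefficient `cₙ₊₁` of a solution of `IsPFCoeff`, in terms of `c = cₙ`, `e = eₙ` and
`e' = eₙ₊₁`; here `h = 1 / (n + 1)`. -/
def pfStep (a h : ℝ) (c e e' : Fin 3 → ℝ) : Fin 3 → ℝ :=
  (pfStepMatrix a h)⁻¹ *ᵥ pfStepRhs a h c e e'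

/-- The solution of `IsPFCoeff a e` with constant term `c₀`. -/
def pfCoeff (a : ℝ) (e : ℕ → Fin 3 → ℝ) (c₀ : Fin 3 → ℝ) : ℕ → Fin 3 → ℝ
  | 0 => c₀
  | n + 1 => pfStep a (n + 1 : ℝ)⁻¹ (pfCoeff a e c₀ n) (e n) (e (n + 1))

variable {a : ℝ}

theorem det_pfStepMatrix (h : ℝ) :
    (pfStepMatrix a h).det = -2 * (a - 2) ^ 2 * (3 + 2 * a - a ^ 2) := by
  simp only [pfStepMatrix, det_fin_three, of_apply, cons_val]
  ring

theorem det_pfStepMatrix_ne_zero (ha1 : a ≠ -1) (ha2 : a ≠ 2) (ha3 : a ≠ 3) (h : ℝ) :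
    (pfStepMatrix a h).det ≠ 0 := by
  have hfactor : 3 + 2 * a - a ^ 2 = (a + 1) * (3 - a) := by ring
  rw [det_pfStepMatrix, hfactor]
  exact mul_ne_zero (mul_ne_zero (by norm_num) (pow_ne_zero 2 (sub_ne_zero.2 ha2)))
    (mul_ne_zero (fun h => ha1 (eq_neg_of_add_eq_zero_left h)) (sub_ne_zero.2 ha3.symm))

theorem eq_pfStep_iff (ha1 : a ≠ -1) (ha2 : a ≠ 2) (ha3 : a ≠ 3) {h : ℝ} {x c e e' : Fin 3 → ℝ} :
    x = pfStep a h c e e' ↔ pfStepMatrix a h *ᵥ x = pfStepRhs a h c e e' := by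
  have hunit := (det_pfStepMatrix_ne_zero ha1 ha2 ha3 h).isUnit
  constructor
  · rintro rfl
    rw [pfStep, mulVec_mulVec, mul_nonsing_inv _ hunit, one_mulVec]
  · intro hx
    rw [pfStep, ← hx, mulVec_mulVec, nonsing_inv_mul _ hunit, one_mulVec]

theorem isPFCoeff_pfCoeff (ha1 : a ≠ -1) (ha2 : a ≠ 2) (ha3 : a ≠ 3) {e : ℕ → Fin 3 → ℝ}
    {c₀ : Fin 3 → ℝ} (h0 : (pfLinear a *ᵥ e 0) 2 = (pfRhs a *ᵥ c₀) 2) :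
    IsPFCoeff a e (pfCoeff a e c₀) := by
  set c := pfCoeff a e c₀
  have hstep : ∀ n : ℕ, pfStepMatrix a (n + 1 : ℝ)⁻¹ *ᵥ c (n + 1) =
    pfStepRhs a (n + 1 : ℝ)⁻¹ (c n) (e n) (e (n + 1)) := fun n => (eq_pfStep_iff ha1 ha2 ha3).1 rfl
  simp only [pfStepMatrix, pfStepRhs, pfConst, pfLinear, pfRhs, funext_iff, Fin.forall_fin_succ,
    IsEmpty.forall_iff, and_true, mulVec, dotProduct, Fin.sum_univ_three, Fin.succ_zero_eq_one,
    Fin.succ_one_eq_two, of_apply, cons_val, Pi.sub_apply, Pi.smul_apply, Pi.add_apply,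
    Matrix.sub_apply, Matrix.smul_apply, smul_eq_mul] at hstep h0
  intro n
  have hn : (n + 1 : ℝ) ≠ 0 := by positivity
  ext i
  fin_cases i
  all_goals simp only [pfConst, pfLinear, pfRhs, Fin.zero_eta, Fin.mk_one, Fin.reduceFinMk, mulVec,
    dotProduct, Fin.sum_univ_three, of_apply, cons_val, Pi.smul_apply, Pi.add_apply, smul_eq_mul]
  · have h := (hstep n).1
    field_simp at h
    linear_combination (1 / 3) * h
  · have h := (hstep n).2.1
    field_simp at h
    linear_combination (1 / 3) * h
  · cases n with
    | zero =>
      change _ = _ * c₀ 0 + _ * c₀ 1 + _ * c₀ 2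
      linear_combination h0
    | succ m =>
      have h := (hstep m).2.2
      push_cast at hn ⊢
      have hm : (m + 1 : ℝ) ≠ 0 := by positivity
      field_simp at h
      linear_combination (1 / 2) * h

theorem continuous_pfStep (a : ℝ) :
    Continuous fun p : ℝ × (Fin 3 → ℝ) × (Fin 3 → ℝ) × (Fin 3 → ℝ) =>
      pfStep a p.1 p.2.1 p.2.2.1 p.2.2.2 := by
  have hM : Continuous (pfStepMatrix a) := by
    refine continuous_matrix fun i j => ?_
    fin_cases i <;> fin_cases j <;> simp only [pfStepMatrix, Fin.zero_eta, Fin.mk_one,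
      Fin.reduceFinMk, of_apply, cons_val] <;> fun_prop
  have hinv : Continuous fun h => (pfStepMatrix a h)⁻¹ := by
    simp only [inv_def, det_pfStepMatrix]
    exact hM.matrix_adjugate.const_smul (Ring.inverse (-2 * (a - 2) ^ 2 * (3 + 2 * a - a ^ 2)))
  refine (hinv.comp continuous_fst).matrix_mulVec (continuous_pi fun i => ?_)
  fin_cases i <;> simp only [pfStepRhs, mulVec, dotProduct, Fin.zero_eta, Fin.mk_one,
    Fin.reduceFinMk, cons_val, Pi.sub_apply, Pi.add_apply, Pi.smul_apply, Matrix.sub_apply,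
    Matrix.smul_apply, smul_eq_mul] <;> fun_prop

theorem pfStep_smul (h k : ℝ) (c e e' : Fin 3 → ℝ) :
    pfStep a h (k • c) (k • e) (k • e') = k • pfStep a h c e e' := by
  have hrhs : pfStepRhs a h (k • c) (k • e) (k • e') = k • pfStepRhs a h c e e' := by
    ext i
    fin_cases i <;> simp [pfStepRhs, mulVec_smul] <;> ring
  rw [pfStep, hrhs, mulVec_smul, pfStep]

theorem exists_geometric_pfCoeff {e : ℕ → Fin 3 → ℝ} {K C : ℝ} (he : ∀ n, ‖e n‖ ≤ K ^ n * C)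
    (c₀ : Fin 3 → ℝ) : ∃ K' C', ∀ n, ‖pfCoeff a e c₀ n‖ ≤ K' ^ n * C' := by
  obtain ⟨A, hA0, hA⟩ := exists_norm_le_mul_norm_of_homogeneous
    (f := fun h (p : (Fin 3 → ℝ) × (Fin 3 → ℝ) × (Fin 3 → ℝ)) => pfStep a h p.1 p.2.1 p.2.2)
    (isCompact_Icc (a := (0 : ℝ)) (b := 1)) (continuous_pfStep a)
    fun h k p => pfStep_smul h k p.1 p.2.1 p.2.2
  refine exists_geometric_of_le_mul_max hA0 he fun n => hA (n + 1 : ℝ)⁻¹ ⟨by positivity, ?_⟩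
    (pfCoeff a e c₀ n, e n, e (n + 1))
  exact inv_le_one_of_one_le₀ (by linarith [n.cast_nonneg (α := ℝ)])

/-- The coefficients of the holomorphic solution `Q`. -/
def holCoeff (a : ℝ) : ℕ → Fin 3 → ℝ := pfCoeff a 0 ![1, 0, 0]

/-- The coefficients of the holomorphic part `S` of the logarithmic solution. Its constant term
is a solution `s₀` of `(B s₀)₂ = (A₁ q₀)₂ = a - 2`. -/
def logCoeff (a : ℝ) : ℕ → Fin 3 → ℝ :=
  pfCoeff a (holCoeff a) (((a - 2) / ((3 / 2 * (1 - a)) ^ 2 + a ^ 2)) • ![0, 3 / 2 * (1 - a), a])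

theorem pfRhs_mulVec_logCoeff_zero (a : ℝ) : (pfRhs a *ᵥ logCoeff a 0) 2 = a - 2 := by
  have hpos : (3 / 2 * (1 - a)) ^ 2 + a ^ 2 ≠ 0 := by nlinarith [sq_nonneg (a - 1), sq_nonneg a]
  have hval : (pfRhs a *ᵥ ![0, 3 / 2 * (1 - a), a]) 2 = (3 / 2 * (1 - a)) ^ 2 + a ^ 2 := by
    simp only [pfRhs, mulVec, dotProduct, Fin.sum_univ_three, of_apply, cons_val]
    ring
  rw [logCoeff, pfCoeff, mulVec_smul, Pi.smul_apply, hval, smul_eq_mul, div_mul_cancel₀ _ hpos]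

theorem pfLinear_mulVec_holCoeff_zero (a : ℝ) : (pfLinear a *ᵥ holCoeff a 0) 2 = a - 2 := by
  simp [holCoeff, pfCoeff, pfLinear]

theorem isPFCoeff_holCoeff (ha1 : a ≠ -1) (ha2 : a ≠ 2) (ha3 : a ≠ 3) :
    IsPFCoeff a 0 (holCoeff a) :=
  isPFCoeff_pfCoeff ha1 ha2 ha3 (by simp [pfRhs])

theorem isPFCoeff_logCoeff (ha1 : a ≠ -1) (ha2 : a ≠ 2) (ha3 : a ≠ 3) :
    IsPFCoeff a (holCoeff a) (logCoeff a) :=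
  isPFCoeff_pfCoeff ha1 ha2 ha3
    ((pfLinear_mulVec_holCoeff_zero a).trans (pfRhs_mulVec_logCoeff_zero a).symm)

theorem pfConst_mulVec_holCoeff_zero (a : ℝ) : pfConst a *ᵥ holCoeff a 0 = 0 := by
  ext i
  fin_cases i <;> simp [holCoeff, pfCoeff, pfConst]

theorem exists_vecSeriesConverges_holCoeff_logCoeff (a : ℝ) :
    ∃ r > 0, VecSeriesConverges (holCoeff a) r ∧ VecSeriesConverges (logCoeff a) r := by
  obtain ⟨K, C, hq⟩ := exists_geometric_pfCoeff (a := a) (e := 0) (K := 0) (C := 0)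
    (fun n => by simp) ![1, 0, 0]
  obtain ⟨K', C', hs⟩ := exists_geometric_pfCoeff hq _
  obtain ⟨r, hr, hqr⟩ := exists_vecSeriesConverges_of_geometric hq
  obtain ⟨r', hr', hsr⟩ := exists_vecSeriesConverges_of_geometric hs
  exact ⟨min r r', lt_min hr hr', hqr.mono (min_le_left _ _), hsr.mono (min_le_right _ _)⟩

theorem holCoeff_succ_eq_iff (ha1 : a ≠ -1) (ha2 : a ≠ 2) (ha3 : a ≠ 3) {n : ℕ} {x : Fin 3 → ℝ} :
    holCoeff a (n + 1) = x ↔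
      pfStepMatrix a (n + 1 : ℝ)⁻¹ *ᵥ x = pfStepRhs a (n + 1 : ℝ)⁻¹ (holCoeff a n) 0 0 :=
  eq_comm.trans (eq_pfStep_iff ha1 ha2 ha3)

theorem holCoeff_one (ha1 : a ≠ -1) (ha2 : a ≠ 2) (ha3 : a ≠ 3) :
    holCoeff a 1 = -![(a - 1) / (12 * (a - 2) ^ 2), 1 / (6 * (a - 2)), 0] := by
  have h2 : a - 2 ≠ 0 := sub_ne_zero.2 ha2
  refine (holCoeff_succ_eq_iff ha1 ha2 ha3).2 ?_
  ext i
  fin_cases i <;> simp [pfStepMatrix, pfStepRhs, pfRhs, pfLinear, holCoeff, pfCoeff] <;>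
    field_simp <;> ring

theorem holCoeff_two (ha1 : a ≠ -1) (ha2 : a ≠ 2) (ha3 : a ≠ 3) :
    holCoeff a 2 = -![(11 * a ^ 2 - 22 * a + 15) / (576 * (a - 2) ^ 4),
      (a - 1) / (48 * (a - 2) ^ 3), 1 / (72 * (a - 2) ^ 2)] := by
  have h2 : a - 2 ≠ 0 := sub_ne_zero.2 ha2
  refine (holCoeff_succ_eq_iff ha1 ha2 ha3).2 ?_
  rw [holCoeff_one ha1 ha2 ha3]
  ext i
  fin_cases i <;> simp [pfStepMatrix, pfStepRhs, pfRhs, pfLinear] <;> field_simp <;> ring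

theorem holCoeff_three (ha1 : a ≠ -1) (ha2 : a ≠ 2) (ha3 : a ≠ 3) :
    holCoeff a 3 = -![35 * (a - 1) * (5 * a ^ 2 - 10 * a + 9) / (20736 * (a - 2) ^ 6),
      (85 * a ^ 2 - 170 * a + 105) / (10368 * (a - 2) ^ 5),
      5 * (a - 1) / (864 * (a - 2) ^ 4)] := by
  have h2 : a - 2 ≠ 0 := sub_ne_zero.2 ha2
  refine (holCoeff_succ_eq_iff ha1 ha2 ha3).2 ?_
  rw [holCoeff_two ha1 ha2 ha3]
  ext i
  fin_cases i <;> simp [pfStepMatrix, pfStepRhs, pfRhs, pfLinear] <;> field_simp <;> ring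

end Recursion

section FundamentalSystem

/-- The coefficients of a polynomial solution, which is proportional to `linP` if `a ≠ 0`. -/
def polyCoeff (a : ℝ) : ℕ → Fin 3 → ℝ
  | 0 => ![8 / 3 * a ^ 2 * (a - 1), 2 / 3 * a * (3 + 2 * a - a ^ 2),
      (a - 1) * (3 + 2 * a - a ^ 2)]
  | 1 => ![0, 0, 8 / 9 * a ^ 2]
  | _ + 2 => 0

theorem isPFCoeff_polyCoeff (a : ℝ) : IsPFCoeff a 0 (polyCoeff a) := by
  intro n
  match n with
  | 0 =>
    ext i
    fin_cases i <;> simp [pfConst, pfLinear, pfRhs, polyCoeff] <;> ring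
  | 1 =>
    ext i
    fin_cases i <;> simp [pfConst, pfLinear, pfRhs, polyCoeff]
  | n + 2 => simp [polyCoeff]

theorem vecSeriesConverges_polyCoeff (a r : ℝ) : VecSeriesConverges (polyCoeff a) r := by
  intro i x _
  refine (summable_nat_add_iff 2).1 ?_
  simp [polyCoeff, summable_zero]

theorem linP_eq_smul_vecSeries (ha : a ≠ 0) :
    (linP a : 𝕜 → Fin 3 → 𝕜) = fun t => (9 / (8 * (a : 𝕜) ^ 2)) • vecSeries (polyCoeff a) t := by
  have ha' : (a : 𝕜) ≠ 0 := RCLike.ofReal_ne_zero.2 ha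
  ext t i
  have hsum : vecSeries (polyCoeff a) t i = (polyCoeff a 0 i : 𝕜) + (polyCoeff a 1 i : 𝕜) * t := by
    have htsum : vecSeries (polyCoeff a) t i =
        ∑ n ∈ Finset.range 2, (polyCoeff a n i : 𝕜) * t ^ n := tsum_eq_sum fun n hn => by
      obtain ⟨m, rfl⟩ := Nat.exists_eq_add_of_le' (not_lt.1 (mt Finset.mem_range.2 hn))
      simp [polyCoeff]
    simpa [Finset.sum_range_succ] using htsum
  rw [Pi.smul_apply, hsum]
  fin_cases i <;> simp [linP, polyCoeff, map_ofNat] <;> field_simp <;> ring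

/-- The Wronskian of the polynomial, the holomorphic and the logarithmic solutions. The multiple
of `Q` in the logarithmic solution does not contribute, so that the Wronskian is holomorphic. -/
def pfWronskian (a : ℝ) (t : 𝕜) : 𝕜 :=
  (of ![vecSeries (polyCoeff a) t, vecSeries (holCoeff a) t, vecSeries (logCoeff a) t]).det

theorem pfWronskian_zero (a : ℝ) :
    pfWronskian a (0 : 𝕜) = -(2 / 3) * (3 + 2 * (a : 𝕜) - (a : 𝕜) ^ 2) * ((a : 𝕜) - 2) := by
  have hmap : of ![vecSeries (polyCoeff a) (0 : 𝕜), vecSeries (holCoeff a) 0,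
      vecSeries (logCoeff a) 0] =
      (of ![polyCoeff a 0, holCoeff a 0, logCoeff a 0]).map (algebraMap ℝ 𝕜) := by
    ext i j
    fin_cases i <;> simp [vecSeries_zero]
  have hdet : (of ![polyCoeff a 0, holCoeff a 0, logCoeff a 0]).det =
      -(2 / 3) * (3 + 2 * a - a ^ 2) * (a - 2) := by
    have hlog := pfRhs_mulVec_logCoeff_zero a
    simp only [pfRhs, mulVec, dotProduct, Fin.sum_univ_three, of_apply, cons_val] at hlog
    simp only [polyCoeff, holCoeff, pfCoeff, det_fin_three, of_apply, cons_val]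
    linear_combination (-(2 / 3) * (3 + 2 * a - a ^ 2)) * hlog
  rw [pfWronskian, hmap, ← RingHom.mapMatrix_apply, ← RingHom.map_det, hdet]
  simp [map_ofNat]

/-- The conditions on `r` under which the solutions form a fundamental system for `0 < |t| < r`. -/
structure IsPFRadius (𝕜 : Type) [RCLike 𝕜] (a r : ℝ) : Prop where
  pos : 0 < r
  hol : VecSeriesConverges (holCoeff a) r
  log : VecSeriesConverges (logCoeff a) r
  det_ne_zero : ∀ t : 𝕜, ‖t‖ < r → t ≠ 0 → (pfConst (a : 𝕜) + t • pfLinear (a : 𝕜)).det ≠ 0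
  pfWronskian_ne_zero : ∀ t : 𝕜, ‖t‖ < r → pfWronskian a t ≠ 0

theorem IsPFRadius.mono {r r' : ℝ} (h : IsPFRadius 𝕜 a r) (hpos : 0 < r') (hle : r' ≤ r) :
    IsPFRadius 𝕜 a r' where
  pos := hpos
  hol := h.hol.mono hle
  log := h.log.mono hle
  det_ne_zero t ht := h.det_ne_zero t (ht.trans_le hle)
  pfWronskian_ne_zero t ht := h.pfWronskian_ne_zero t (ht.trans_le hle)

theorem IsPFRadius.le_abs {r : ℝ} (h : IsPFRadius ℝ a r) (ha3 : a ≠ 3) : r ≤ |3 - a| := by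
  by_contra! hlt
  refine h.det_ne_zero (a - 3) (by rwa [Real.norm_eq_abs, abs_sub_comm]) (sub_ne_zero.2 ha3) ?_
  rw [RCLike.ofReal_real_eq_id, id, det_pfConst_add_smul_pfLinear]
  ring

theorem exists_isPFRadius (𝕜 : Type) [RCLike 𝕜] (ha1 : a ≠ -1) (ha2 : a ≠ 2) (ha3 : a ≠ 3) :
    ∃ r, IsPFRadius 𝕜 a r := by
  obtain ⟨r, hr, hqr, hsr⟩ := exists_vecSeriesConverges_holCoeff_logCoeff a
  have h1 : (a : 𝕜) + 1 ≠ 0 := by exact_mod_cast fun h => ha1 (eq_neg_of_add_eq_zero_left h)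
  have h2 : (a : 𝕜) - 2 ≠ 0 := by exact_mod_cast sub_ne_zero.2 ha2
  have h3 : 3 - (a : 𝕜) ≠ 0 := by exact_mod_cast sub_ne_zero.2 ha3.symm
  have hdet : ∀ᶠ t : 𝕜 in 𝓝 0,
      (t + 3 - (a : 𝕜)) * ((a : 𝕜) ^ 2 * t - ((a : 𝕜) + 1) * ((a : 𝕜) - 2) ^ 2) ≠ 0 := by
    refine ContinuousAt.eventually_ne (by fun_prop) ?_
    rw [zero_add, mul_zero, zero_sub]
    exact mul_ne_zero h3 (neg_ne_zero.2 (mul_ne_zero h1 (pow_ne_zero 2 h2)))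
  have hwronskian : ∀ᶠ t : 𝕜 in 𝓝 0, pfWronskian a t ≠ 0 := by
    have h0r : ‖(0 : 𝕜)‖ < r := norm_zero.trans_lt hr
    refine (differentiableAt_det fun i => ?_).continuousAt.eventually_ne ?_
    · fin_cases i
      exacts [((vecSeriesConverges_polyCoeff a r).hasDerivAt h0r).differentiableAt,
        (hqr.hasDerivAt h0r).differentiableAt, (hsr.hasDerivAt h0r).differentiableAt]
    · have hfactor : 3 + 2 * (a : 𝕜) - (a : 𝕜) ^ 2 = ((a : 𝕜) + 1) * (3 - (a : 𝕜)) := by ring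
      have hzero := pfWronskian_zero (𝕜 := 𝕜) a
      rw [hfactor] at hzero
      exact hzero.trans_ne
        (mul_ne_zero (mul_ne_zero (neg_ne_zero.2 (by norm_num)) (mul_ne_zero h1 h3)) h2)
  obtain ⟨ρ, hρ, h⟩ := Metric.eventually_nhds_iff.1 (hdet.and hwronskian)
  refine ⟨min r ρ, lt_min hr hρ, hqr.mono (min_le_left _ _), hsr.mono (min_le_left _ _),
    fun t ht ht0 => ?_, fun t ht => (h ?_).2⟩
  · have hne := (h ((dist_zero_right t).trans_lt (ht.trans_le (min_le_right _ _)))).1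
    rw [det_pfConst_add_smul_pfLinear, mul_assoc]
    exact mul_ne_zero (mul_ne_zero two_ne_zero ht0) hne
  · exact (dist_zero_right t).trans_lt (ht.trans_le (min_le_right _ _))

theorem IsPFSolution.const_smul {U : Set 𝕜} {J : 𝕜 → Fin 3 → 𝕜} (h : IsPFSolution a U J) (k : 𝕜) :
    IsPFSolution a U fun t => k • J t := by
  refine isPFSolution_iff.2 fun t ht => ?_
  obtain ⟨hdiff, hderiv⟩ := isPFSolution_iff.1 h t ht
  refine ⟨hdiff.const_smul k, ?_⟩
  rw [deriv_fun_const_smul k hdiff, mulVec_smul, hderiv, mulVec_smul]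

theorem IsPFRadius.isPFFundamental (ha1 : a ≠ -1) (ha2 : a ≠ 2) (ha3 : a ≠ 3) {r : ℝ}
    (hr : IsPFRadius 𝕜 a r) {U : Set 𝕜} (hUo : IsOpen U) (hUc : IsConnected U) {l : 𝕜 → 𝕜}
    (hU : ∀ t ∈ U, ‖t‖ < r ∧ t ≠ 0 ∧ HasDerivAt l t⁻¹ t) {k : 𝕜} (hk : k ≠ 0) :
    IsPFFundamental a U ![fun t => k • vecSeries (polyCoeff a) t, vecSeries (holCoeff a),
      fun t => l t • vecSeries (holCoeff a) t + vecSeries (logCoeff a) t] := by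
  have hball : U ⊆ Metric.ball 0 r := fun t ht => mem_ball_zero_iff.2 (hU t ht).1
  have hsol : ∀ i, IsPFSolution a U ((![fun t => k • vecSeries (polyCoeff a) t,
      vecSeries (holCoeff a), fun t => l t • vecSeries (holCoeff a) t + vecSeries (logCoeff a) t] :
      Fin 3 → 𝕜 → Fin 3 → 𝕜) i) := by
    intro i
    have hp := (isPFCoeff_polyCoeff a).isPFSolution (𝕜 := 𝕜) (vecSeriesConverges_polyCoeff a r)
    have hq := (isPFCoeff_holCoeff ha1 ha2 ha3).isPFSolution (𝕜 := 𝕜) hr.hol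
    fin_cases i
    · exact fun t ht => hp.const_smul k t (hball ht)
    · exact fun t ht => hq t (hball ht)
    · exact (isPFCoeff_holCoeff ha1 ha2 ha3).isPFSolution_log (isPFCoeff_logCoeff ha1 ha2 ha3)
        (pfConst_mulVec_holCoeff_zero a) hr.hol hr.log hU
  refine ⟨hsol, fun J hJ => IsLinearSystemSolution.existsUnique_eq_sum_smul hUo hUc
    (fun t ht => hr.det_ne_zero t (hU t ht).1 (hU t ht).2.1) (fun i => isPFSolution_iff.1 (hsol i))
    (fun t ht => ?_) (isPFSolution_iff.1 hJ)⟩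
  convert mul_ne_zero hk (hr.pfWronskian_ne_zero t (hU t ht).1) using 1
  simp only [pfWronskian, det_fin_three, of_apply, cons_val, Pi.add_apply, Pi.smul_apply,
    smul_eq_mul]
  ring

theorem IsPFRadius.isPFFundamental_logSystem (ha0 : a ≠ 0) (ha1 : a ≠ -1) (ha2 : a ≠ 2)
    (ha3 : a ≠ 3) {r : ℝ} (hr : IsPFRadius 𝕜 a r) {U : Set 𝕜} (hUo : IsOpen U)
    (hUc : IsConnected U) {l : 𝕜 → 𝕜} (hU : ∀ t ∈ U, ‖t‖ < r ∧ t ≠ 0 ∧ HasDerivAt l t⁻¹ t) :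
    IsPFFundamental a U (logSystem a (holCoeff a) (logCoeff a) l) := by
  have ha0' : (a : 𝕜) ≠ 0 := RCLike.ofReal_ne_zero.2 ha0
  rw [logSystem, linP_eq_smul_vecSeries ha0]
  exact hr.isPFFundamental ha1 ha2 ha3 hUo hUc hU
    (div_ne_zero (by norm_num) (mul_ne_zero (by norm_num) (pow_ne_zero 2 ha0')))

theorem hasDerivAt_inv_of_exp_eq {U : Set ℂ} (hU : IsOpen U) {l : ℂ → ℂ} (hl : ContinuousOn l U)
    (hexp : ∀ t ∈ U, Complex.exp (l t) = t) {t : ℂ} (ht : t ∈ U) : HasDerivAt l t⁻¹ t := by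
  have hderiv := (Complex.hasDerivAt_exp (l t)).of_local_left_inverse
    (hl.continuousAt (hU.mem_nhds ht)) (Complex.exp_ne_zero _)
    (eventually_of_mem (hU.mem_nhds ht) hexp)
  rwa [hexp t ht] at hderiv

theorem IsPFRadius.isPFFundamental_logSystem_real (ha0 : a ≠ 0) (ha1 : a ≠ -1) (ha2 : a ≠ 2)
    (ha3 : a ≠ 3) {r : ℝ} (hr : IsPFRadius ℝ a r) {U : Set ℝ} (hUo : IsOpen U)
    (hUc : IsConnected U) (hU : U ⊆ Metric.ball 0 r \ {0}) :
    IsPFFundamental a U (logSystem a (holCoeff a) (logCoeff a) Real.log) :=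
  hr.isPFFundamental_logSystem ha0 ha1 ha2 ha3 hUo hUc fun _ ht =>
    ⟨mem_ball_zero_iff.1 (hU ht).1, (hU ht).2, Real.hasDerivAt_log (hU ht).2⟩

theorem IsPFRadius.isPFFundamental_logSystem_complex (ha0 : a ≠ 0) (ha1 : a ≠ -1) (ha2 : a ≠ 2)
    (ha3 : a ≠ 3) {r : ℝ} (hr : IsPFRadius ℂ a r) {U : Set ℂ} (hUo : IsOpen U)
    (hUc : IsConnected U) (hU : U ⊆ Metric.ball 0 r \ {0}) {l : ℂ → ℂ} (hl : ContinuousOn l U)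
    (hexp : ∀ t ∈ U, Complex.exp (l t) = t) :
    IsPFFundamental a U (logSystem a (holCoeff a) (logCoeff a) l) :=
  hr.isPFFundamental_logSystem ha0 ha1 ha2 ha3 hUo hUc fun _ ht =>
    ⟨mem_ball_zero_iff.1 (hU ht).1, (hU ht).2, hasDerivAt_inv_of_exp_eq hUo hl hexp ht⟩

end FundamentalSystem


section LogExpansion

variable {r : ℝ}

/-- The right-hand side of the last equation of the system, as a linear functional. On a solution
its limit at `0` detects the coefficient of the logarithm. -/
def pfResidue (a : ℝ) : (Fin 3 → ℝ) →L[ℝ] ℝ :=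
  (ContinuousLinearMap.proj 2).comp (pfRhs a).mulVecLin.toContinuousLinearMap

theorem pfResidue_apply (a : ℝ) (v : Fin 3 → ℝ) : pfResidue a v = (pfRhs a *ᵥ v) 2 := rfl

theorem IsPFCoeff.pfResidue_eq_zero {c : ℕ → Fin 3 → ℝ} (h : IsPFCoeff a 0 c) :
    pfResidue a (c 0) = 0 := by
  rw [pfResidue_apply, ← h 0]
  simp [pfConst, dotProduct, Fin.sum_univ_three]

theorem IsPFRadius.exists_log_expansion (ha1 : a ≠ -1) (ha2 : a ≠ 2) (ha3 : a ≠ 3)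
    (hr : IsPFRadius ℝ a r) {J : ℝ → Fin 3 → ℝ} (hJ : IsPFSolution a (Ioo (-r) 0) J) :
    ∃ (k : ℝ) (d : ℕ → Fin 3 → ℝ), VecSeriesConverges d r ∧ pfResidue a (d 0) = k * (a - 2) ∧
      ∀ t ∈ Ioo (-r) 0, J t = (k * Real.log t) • vecSeries (holCoeff a) t + vecSeries d t := by
  have hU : ∀ t ∈ Ioo (-r) 0, ‖t‖ < r ∧ t ≠ 0 ∧ HasDerivAt Real.log t⁻¹ t := fun t ht =>
    ⟨abs_lt.2 ⟨ht.1, ht.2.trans hr.pos⟩, ht.2.ne, Real.hasDerivAt_log ht.2.ne⟩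
  obtain ⟨k, hk, -⟩ := (hr.isPFFundamental ha1 ha2 ha3 isOpen_Ioo
    (isConnected_Ioo (neg_lt_zero.2 hr.pos)) hU one_ne_zero).2 J hJ
  have hp := (vecSeriesConverges_polyCoeff a r).const_smul (k 0)
  have hq := hr.hol.const_smul (k 1)
  have hs := hr.log.const_smul (k 2)
  refine ⟨k 2, k 0 • polyCoeff a + k 1 • holCoeff a + k 2 • logCoeff a, (hp.add hq).add hs, ?_,
    fun t ht => ?_⟩
  · simp only [Pi.add_apply, Pi.smul_apply, map_add, map_smul,
      (isPFCoeff_polyCoeff a).pfResidue_eq_zero,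
      (isPFCoeff_holCoeff ha1 ha2 ha3).pfResidue_eq_zero, pfResidue_apply a (logCoeff a 0),
      pfRhs_mulVec_logCoeff_zero, smul_eq_mul, mul_zero, zero_add]
  · rw [hk t ht, vecSeries_add (hp.add hq) hs (hU t ht).1, vecSeries_add hp hq (hU t ht).1]
    simp only [Fin.sum_univ_three, cons_val, vecSeries_const_smul, RCLike.ofReal_real_eq_id, id]
    module

theorem tendsto_log_mul_nhdsLT_zero_of_hasDerivAt {f : ℝ → ℝ} {f' : ℝ} (hf : HasDerivAt f f' 0)
    (h0 : f 0 = 0) : Tendsto (fun t => Real.log t * f t) (𝓝[<] 0) (𝓝 0) := by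
  have hslope : Tendsto (fun t => t⁻¹ * f t) (𝓝[<] 0) (𝓝 f') := by
    have := hasDerivAt_iff_tendsto_slope_zero.1 hf
    simp only [zero_add, h0, sub_zero, smul_eq_mul] at this
    exact this.mono_left (nhdsWithin_mono _ fun x (hx : x < 0) => hx.ne)
  have hmul := tendsto_log_mul_self_nhdsLT_zero.mul hslope
  rw [zero_mul] at hmul
  refine hmul.congr' ?_
  filter_upwards [self_mem_nhdsWithin] with t ht
  rw [mul_assoc, mul_inv_cancel_left₀ (mem_Iio.1 ht).ne]

theorem tendsto_pfResidue_log_expansion {q d : ℕ → Fin 3 → ℝ} (hq : VecSeriesConverges q r)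
    (hd : VecSeriesConverges d r) (hr : 0 < r) (hq0 : pfResidue a (q 0) = 0) (k : ℝ) :
    Tendsto (fun t => pfResidue a ((k * Real.log t) • vecSeries q t + vecSeries d t)) (𝓝[<] 0)
      (𝓝 (pfResidue a (d 0))) := by
  have h0r : ‖(0 : ℝ)‖ < r := norm_zero.trans_lt hr
  have hlog := tendsto_log_mul_nhdsLT_zero_of_hasDerivAt
    ((pfResidue a).hasFDerivAt.comp_hasDerivAt 0 (hq.hasDerivAt h0r)) <| by
      rw [Function.comp_apply, vecSeries_zero]
      exact hq0
  have hreg : Tendsto (fun t => pfResidue a (vecSeries d t)) (𝓝[<] 0) (𝓝 (pfResidue a (d 0))) := by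
    have := ((pfResidue a).continuous.continuousAt.comp (hd.hasDerivAt h0r).continuousAt).tendsto
    rw [Function.comp_apply, vecSeries_zero] at this
    exact this.mono_left nhdsWithin_le_nhds
  have hsum := (hlog.const_mul k).add hreg
  rw [mul_zero, zero_add] at hsum
  refine hsum.congr fun t => ?_
  simp only [Function.comp_apply, map_add, map_smul, smul_eq_mul, mul_assoc]

end LogExpansion

end PicardFuchs

section Radial

/-- The radial coordinate on the `x`-axis: `radial a x ^ 2 = H(x, 0) - H(1, 0)`. -/
def radial (a x : ℝ) : ℝ := (x - 1) * √(a * (x - 1) + 3)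

/-- The critical level curve `H = 0` consists of the `y`-axis and the conic `y ^ 2 = conic a x`. -/
def conic (a x : ℝ) : ℝ := -a * x ^ 2 + 3 * (a - 1) * x + 3 * (2 - a)

/-- The derivative of the radial coordinate. -/
def radialDeriv (a x : ℝ) : ℝ := 3 * (a * (x - 1) + 2) / (2 * √(a * (x - 1) + 3))

variable {a : ℝ}

theorem neg_two_lt_mul (ha : -1 < a) (ha' : a < 2) {x : ℝ} (hx : x ∈ Icc (0 : ℝ) 3) :
    -2 < a * (x - 1) := by
  obtain ⟨h0, h3⟩ := hx
  rcases le_total 1 x with h | h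
  · nlinarith [mul_nonneg (by linarith : 0 ≤ a + 1) (by linarith : 0 ≤ x - 1)]
  · nlinarith [mul_nonneg (by linarith : 0 ≤ 2 - a) (by linarith : 0 ≤ 1 - x)]

theorem sqrt_slope_pos (ha : -1 < a) (ha' : a < 2) {x : ℝ} (hx : x ∈ Icc (0 : ℝ) 3) :
    0 < √(a * (x - 1) + 3) :=
  Real.sqrt_pos.2 (by linarith [neg_two_lt_mul ha ha' hx])

theorem radialDeriv_pos (ha : -1 < a) (ha' : a < 2) {x : ℝ} (hx : x ∈ Icc (0 : ℝ) 3) :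
    0 < radialDeriv a x :=
  div_pos (by linarith [neg_two_lt_mul ha ha' hx]) (by linarith [sqrt_slope_pos ha ha' hx])

theorem radial_sq (ha : -1 < a) (ha' : a < 2) {x : ℝ} (hx : x ∈ Icc (0 : ℝ) 3) :
    radial a x ^ 2 = (x - 1) ^ 2 * (a * (x - 1) + 3) := by
  rw [radial, mul_pow, Real.sq_sqrt (by linarith [neg_two_lt_mul ha ha' hx])]

theorem hamH_eq (ha : -1 < a) (ha' : a < 2) {x : ℝ} (hx : x ∈ Icc (0 : ℝ) 3) (y : ℝ) :
    hamH a x y = x * y ^ 2 + radial a x ^ 2 - (3 - a) := by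
  rw [radial_sq ha ha' hx, hamH]; ring

theorem radial_mul_radialDeriv (ha : -1 < a) (ha' : a < 2) {x : ℝ} (hx : x ∈ Icc (0 : ℝ) 3) :
    radial a x * radialDeriv a x = 3 / 2 * (x - 1) * (a * (x - 1) + 2) := by
  have := (sqrt_slope_pos ha ha' hx).ne'
  rw [radial, radialDeriv]
  generalize √(a * (x - 1) + 3) = s at *
  field_simp

theorem hasDerivAt_radial (ha : -1 < a) (ha' : a < 2) {x : ℝ} (hx : x ∈ Icc (0 : ℝ) 3) :
    HasDerivAt (radial a) (radialDeriv a x) x := by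
  have := sqrt_slope_pos ha ha' hx
  have hpos : 0 < a * (x - 1) + 3 := by linarith [neg_two_lt_mul ha ha' hx]
  have h1 : HasDerivAt (fun x : ℝ => x - 1) 1 x := (hasDerivAt_id x).sub_const 1
  have h2 := ((h1.const_mul a).add_const 3).sqrt hpos.ne'
  refine (h1.mul h2).congr_deriv ?_
  have hsq := Real.sq_sqrt hpos.le
  rw [radialDeriv]
  field_simp
  rw [hsq]; ring

theorem continuousOn_radial (ha : -1 < a) (ha' : a < 2) : ContinuousOn (radial a) (Icc 0 3) :=
  fun _ hx => (hasDerivAt_radial ha ha' hx).continuousAt.continuousWithinAt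

theorem strictMonoOn_radial (ha : -1 < a) (ha' : a < 2) : StrictMonoOn (radial a) (Icc 0 3) := by
  refine strictMonoOn_of_deriv_pos (convex_Icc 0 3) (continuousOn_radial ha ha') fun x hx => ?_
  have hx' := interior_subset hx
  rw [(hasDerivAt_radial ha ha' hx').deriv]
  exact radialDeriv_pos ha ha' hx'

theorem continuousOn_radialDeriv (ha : -1 < a) (ha' : a < 2) :
    ContinuousOn (radialDeriv a) (Icc 0 3) := by
  unfold radialDeriv
  refine ContinuousOn.div (by fun_prop) (by fun_prop) fun x hx => ?_
  have := sqrt_slope_pos ha ha' hx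
  positivity

theorem radial_zero (a : ℝ) : radial a 0 = -√(3 - a) := by
  rw [radial, show a * (0 - 1) + 3 = 3 - a by ring]; ring

theorem sqrt_lt_radial_three (ha : -1 < a) : √(3 - a) < radial a 3 := by
  have : radial a 3 = √(2 ^ 2 * (2 * a + 3)) := by
    rw [radial, Real.sqrt_mul (by norm_num), Real.sqrt_sq (by norm_num)]
    ring_nf
  rw [this]
  exact (Real.sqrt_lt_sqrt_iff_of_pos (by linarith)).2 (by linarith)

theorem exists_continuous_leftInverse {f : ℝ → ℝ} {a b : ℝ} (hab : a ≤ b)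
    (hc : ContinuousOn f (Icc a b)) (hm : StrictMonoOn f (Icc a b)) :
    ∃ g : ℝ → ℝ, Continuous g ∧ (∀ x ∈ Icc a b, g (f x) = x) ∧
      ∀ u ∈ Icc (f a) (f b), g u ∈ Icc a b ∧ f (g u) = u := by
  have ha : a ∈ Icc a b := left_mem_Icc.2 hab
  have hb : b ∈ Icc a b := right_mem_Icc.2 hab
  have hfab : f a ≤ f b := hm.monotoneOn ha hb hab
  let F : Icc a b → Icc (f a) (f b) := fun x =>
    ⟨f x, hm.monotoneOn ha x.2 x.2.1, hm.monotoneOn x.2 hb x.2.2⟩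
  have hF : StrictMono F := fun x y hxy => hm x.2 y.2 hxy
  have hsurj : Function.Surjective F := by
    rintro ⟨u, hu⟩
    obtain ⟨x, hx, hxu⟩ := intermediate_value_Icc hab hc hu
    exact ⟨⟨x, hx⟩, Subtype.ext hxu⟩
  let e := hF.orderIsoOfSurjective F hsurj
  have he : ∀ x, e x = F x := fun x => rfl
  refine ⟨fun u => (e.symm (projIcc (f a) (f b) hfab u) : ℝ), ?_, fun x hx => ?_, fun u hu => ?_⟩
  · exact continuous_subtype_val.comp (e.symm.continuous.comp continuous_projIcc)
  · have : projIcc (f a) (f b) hfab (f x) = e ⟨x, hx⟩ := by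
      rw [he]
      exact projIcc_of_mem hfab (F ⟨x, hx⟩).2
    simp only [this, OrderIso.symm_apply_apply]
  · refine ⟨(e.symm _).2, ?_⟩
    have : (F (e.symm (projIcc (f a) (f b) hfab u)) : ℝ) = projIcc (f a) (f b) hfab u := by
      rw [← he, OrderIso.apply_symm_apply]
    rw [projIcc_of_mem hfab hu] at this
    simp only [projIcc_of_mem hfab hu]
    exact this

/-- `ξ` is a continuous inverse of the radial coordinate on `[0, 3]`. -/
structure IsRadialInv (a : ℝ) (ξ : ℝ → ℝ) : Prop where
  gt_neg_one : -1 < a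
  lt_two : a < 2
  continuous : Continuous ξ
  left_inv : ∀ x ∈ Icc (0 : ℝ) 3, ξ (radial a x) = x
  mem_Icc : ∀ u ∈ Icc (radial a 0) (radial a 3), ξ u ∈ Icc (0 : ℝ) 3
  right_inv : ∀ u ∈ Icc (radial a 0) (radial a 3), radial a (ξ u) = u

theorem exists_isRadialInv (ha : -1 < a) (ha' : a < 2) : ∃ ξ, IsRadialInv a ξ := by
  obtain ⟨ξ, h1, h2, h3⟩ := exists_continuous_leftInverse (by norm_num : (0 : ℝ) ≤ 3)
    (continuousOn_radial ha ha') (strictMonoOn_radial ha ha')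
  exact ⟨ξ, ha, ha', h1, h2, fun u hu => (h3 u hu).1, fun u hu => (h3 u hu).2⟩

namespace IsRadialInv
variable {a : ℝ} {ξ : ℝ → ℝ}

theorem Icc_subset (h : IsRadialInv a ξ) :
    Icc (-√(3 - a)) (√(3 - a)) ⊆ Icc (radial a 0) (radial a 3) :=
  Icc_subset_Icc (radial_zero a).le (sqrt_lt_radial_three h.gt_neg_one).le

theorem mem_Ioo (h : IsRadialInv a ξ) {u : ℝ} (hu : u ∈ Ioo (-√(3 - a)) √(3 - a)) :
    ξ u ∈ Ioo (0 : ℝ) 3 := by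
  have hI := h.Icc_subset (Ioo_subset_Icc_self hu)
  obtain ⟨h0, h3⟩ := h.mem_Icc u hI
  have hr := h.right_inv u hI
  refine ⟨lt_of_le_of_ne h0 fun e => ?_, lt_of_le_of_ne h3 fun e => ?_⟩
  · rw [← e, radial_zero] at hr; exact hu.1.ne hr
  · rw [e] at hr; exact (hu.2.trans (sqrt_lt_radial_three h.gt_neg_one)).ne' hr

theorem hasDerivAt (h : IsRadialInv a ξ) {u : ℝ} (hu : u ∈ Ioo (-√(3 - a)) √(3 - a)) :
    HasDerivAt ξ (radialDeriv a (ξ u))⁻¹ u := by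
  have hx := Ioo_subset_Icc_self (h.mem_Ioo hu)
  refine HasDerivAt.of_local_left_inverse h.continuous.continuousAt
    (hasDerivAt_radial h.gt_neg_one h.lt_two hx) (radialDeriv_pos h.gt_neg_one h.lt_two hx).ne' ?_
  filter_upwards [Ioo_mem_nhds hu.1 hu.2] with v hv
  exact h.right_inv v (h.Icc_subset (Ioo_subset_Icc_self hv))

theorem sub_sq_eq (h : IsRadialInv a ξ) {u : ℝ} (hu : u ∈ Icc (-√(3 - a)) √(3 - a)) :
    3 - a - u ^ 2 = ξ u * conic a (ξ u) := by
  have hI := h.Icc_subset hu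
  have := radial_sq h.gt_neg_one h.lt_two (h.mem_Icc u hI)
  rw [h.right_inv u hI] at this
  rw [this, conic]; ring

theorem mul_radialDeriv (h : IsRadialInv a ξ) {u : ℝ} (hu : u ∈ Icc (-√(3 - a)) √(3 - a)) :
    u * radialDeriv a (ξ u) = 3 / 2 * (ξ u - 1) * (a * (ξ u - 1) + 2) := by
  have hI := h.Icc_subset hu
  have := radial_mul_radialDeriv h.gt_neg_one h.lt_two (h.mem_Icc u hI)
  rwa [h.right_inv u hI] at this

end IsRadialInv

/-- The vector of the densities `x ^ (k - 1/2) dx / du`, for `k = -1, 0, 1`. -/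
def radialDens (a : ℝ) (ξ : ℝ → ℝ) (u : ℝ) : Fin 3 → ℝ :=
  (radialDeriv a (ξ u))⁻¹ • ![1 / (ξ u * √(ξ u)), 1 / √(ξ u), √(ξ u)]

/-- The vector of the primitives of the densities `radialDens`. -/
def radialPrim (ξ : ℝ → ℝ) (u : ℝ) : Fin 3 → ℝ :=
  ![-2 / √(ξ u), 2 * √(ξ u), 2 / 3 * (ξ u * √(ξ u))]

namespace IsRadialInv

variable {ξ : ℝ → ℝ}

theorem hasDerivAt_radialPrim (h : IsRadialInv a ξ) {u : ℝ} (hu : u ∈ Ioo (-√(3 - a)) √(3 - a)) :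
    HasDerivAt (radialPrim ξ) (radialDens a ξ u) u := by
  have hx := (h.mem_Ioo hu).1
  have hd := h.hasDerivAt hu
  have hs := hd.sqrt hx.ne'
  have hs0 : √(ξ u) ≠ 0 := (Real.sqrt_pos.2 hx).ne'
  have hsq : √(ξ u) ^ 2 = ξ u := Real.sq_sqrt hx.le
  refine hasDerivAt_pi.2 fun k => ?_
  fin_cases k
  · refine ((hasDerivAt_const u (-2 : ℝ)).div hs hs0).congr_deriv ?_
    simp only [radialDens, Pi.smul_apply, smul_eq_mul, Fin.zero_eta, cons_val]
    rw [hsq]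
    field_simp
    ring
  · refine (hs.const_mul 2).congr_deriv ?_
    simp only [radialDens, Pi.smul_apply, smul_eq_mul, Fin.mk_one, cons_val]
    field_simp
  · refine ((hd.mul hs).const_mul (2 / 3)).congr_deriv ?_
    simp only [radialDens, Pi.smul_apply, smul_eq_mul, Fin.reduceFinMk, cons_val]
    generalize (radialDeriv a (ξ u))⁻¹ = R
    generalize √(ξ u) = s at *
    rw [← hsq]
    field_simp
    ring

theorem continuousOn_radialPrim (h : IsRadialInv a ξ) :
    ContinuousOn (radialPrim ξ) (Ioo (-√(3 - a)) √(3 - a)) :=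
  fun _ hu => (h.hasDerivAt_radialPrim hu).continuousAt.continuousWithinAt

theorem continuousOn_radialDens (h : IsRadialInv a ξ) :
    ContinuousOn (radialDens a ξ) (Ioo (-√(3 - a)) √(3 - a)) := by
  have hmem : MapsTo ξ (Ioo (-√(3 - a)) √(3 - a)) (Icc 0 3) :=
    fun u hu => Ioo_subset_Icc_self (h.mem_Ioo hu)
  have hx : ContinuousOn ξ (Ioo (-√(3 - a)) √(3 - a)) := h.continuous.continuousOn
  have hx0 : ∀ u ∈ Ioo (-√(3 - a)) √(3 - a), ξ u ≠ 0 := fun u hu => (h.mem_Ioo hu).1.ne'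
  have hs : ContinuousOn (fun u => √(ξ u)) (Ioo (-√(3 - a)) √(3 - a)) := hx.sqrt
  have hs0 : ∀ u ∈ Ioo (-√(3 - a)) √(3 - a), √(ξ u) ≠ 0 := fun u hu =>
    (Real.sqrt_pos.2 (h.mem_Ioo hu).1).ne'
  refine ContinuousOn.smul (f := fun u => (radialDeriv a (ξ u))⁻¹)
    (g := fun u => ![1 / (ξ u * √(ξ u)), 1 / √(ξ u), √(ξ u)]) ?_ (continuousOn_pi.2 fun k => ?_)
  · exact ((continuousOn_radialDeriv h.gt_neg_one h.lt_two).comp hx hmem).inv₀ fun u hu =>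
      (radialDeriv_pos h.gt_neg_one h.lt_two (hmem hu)).ne'
  · fin_cases k
    exacts [continuousOn_const.div (hx.mul hs) fun u hu => mul_ne_zero (hx0 u hu) (hs0 u hu),
      continuousOn_const.div hs hs0, hs]

end IsRadialInv

end Radial

section CircleIntegral

theorem mul_cos_mem_Ioo {ρ R : ℝ} (hρ : |ρ| < R) (θ : ℝ) : ρ * Real.cos θ ∈ Ioo (-R) R := by
  rw [mem_Ioo, ← abs_lt, abs_mul]
  exact (mul_le_of_le_one_right (abs_nonneg _) (Real.abs_cos_le_one θ)).trans_lt hρ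

theorem continuous_comp_mul_cos {X : Type*} [TopologicalSpace X] {E : ℝ → X} {ρ R : ℝ}
    (hE : ContinuousOn E (Ioo (-R) R)) (hρ : |ρ| < R) : Continuous fun θ => E (ρ * Real.cos θ) :=
  hE.comp_continuous (by fun_prop) (mul_cos_mem_Ioo hρ)

variable {V : Type*} [NormedAddCommGroup V] [NormedSpace ℝ V] {E E' : ℝ → V} {ρ R : ℝ}

theorem continuous_cos_smul_comp_mul_cos (hE : ContinuousOn E (Ioo (-R) R)) (hρ : |ρ| < R) :
    Continuous fun θ => Real.cos θ • E (ρ * Real.cos θ) :=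
  Real.continuous_cos.smul (continuous_comp_mul_cos hE hρ)

theorem continuous_smul_sin_sq_smul_comp_mul_cos (hE : ContinuousOn E (Ioo (-R) R))
    (hρ : |ρ| < R) (c : ℝ) : Continuous fun θ => c • Real.sin θ ^ 2 • E (ρ * Real.cos θ) :=
  ((Real.continuous_sin.pow 2).smul (continuous_comp_mul_cos hE hρ)).const_smul c

theorem integral_cos_smul_sub_sin_sq_smul_eq_zero [CompleteSpace V]
    (hE : ∀ u ∈ Ioo (-R) R, HasDerivAt E (E' u) u) (hE' : ContinuousOn E' (Ioo (-R) R))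
    (hρ : |ρ| < R) :
    ∫ θ in (0 : ℝ)..π, (Real.cos θ • E (ρ * Real.cos θ) -
      ρ • Real.sin θ ^ 2 • E' (ρ * Real.cos θ)) = 0 := by
  have hderiv : ∀ θ : ℝ, HasDerivAt (fun θ => Real.sin θ • E (ρ * Real.cos θ))
      (Real.cos θ • E (ρ * Real.cos θ) - ρ • Real.sin θ ^ 2 • E' (ρ * Real.cos θ)) θ := by
    intro θ
    have hcomp := (hE _ (mul_cos_mem_Ioo hρ θ)).scomp θ ((Real.hasDerivAt_cos θ).const_mul ρ)
    refine ((Real.hasDerivAt_sin θ).smul hcomp).congr_deriv ?_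
    simp only [Function.comp_apply]
    module
  rw [intervalIntegral.integral_eq_sub_of_hasDerivAt (fun θ _ => hderiv θ)
    (((continuous_cos_smul_comp_mul_cos (fun u hu => (hE u hu).continuousAt.continuousWithinAt)
      hρ).sub (continuous_smul_sin_sq_smul_comp_mul_cos hE' hρ ρ)).intervalIntegrable _ _),
    Real.sin_pi, Real.sin_zero, zero_smul, zero_smul, sub_zero]

theorem integral_cos_smul_comp_mul_cos [CompleteSpace V]
    (hE : ∀ u ∈ Ioo (-R) R, HasDerivAt E (E' u) u) (hE' : ContinuousOn E' (Ioo (-R) R))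
    (hρ : |ρ| < R) :
    ∫ θ in (0 : ℝ)..π, Real.cos θ • E (ρ * Real.cos θ) =
      ρ • ∫ θ in (0 : ℝ)..π, Real.sin θ ^ 2 • E' (ρ * Real.cos θ) := by
  rw [← intervalIntegral.integral_smul, ← sub_eq_zero, ← intervalIntegral.integral_sub
    ((continuous_cos_smul_comp_mul_cos (fun u hu => (hE u hu).continuousAt.continuousWithinAt)
      hρ).intervalIntegrable _ _)
    ((continuous_smul_sin_sq_smul_comp_mul_cos hE' hρ ρ).intervalIntegrable _ _)]
  exact integral_cos_smul_sub_sin_sq_smul_eq_zero hE hE' hρ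

theorem hasDerivAt_integral_cos_smul_comp_mul_cos
    (hE : ∀ u ∈ Ioo (-R) R, HasDerivAt E (E' u) u) (hE' : ContinuousOn E' (Ioo (-R) R))
    (hρ : |ρ| < R) :
    HasDerivAt (fun ρ => ∫ θ in (0 : ℝ)..π, Real.cos θ • E (ρ * Real.cos θ))
      (∫ θ in (0 : ℝ)..π, Real.cos θ ^ 2 • E' (ρ * Real.cos θ)) ρ := by
  obtain ⟨R₁, hρ₁, hR₁⟩ := exists_between hρ
  have hEc : ContinuousOn E (Ioo (-R) R) := fun u hu => (hE u hu).continuousAt.continuousWithinAt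
  obtain ⟨C, hC⟩ := (isCompact_Icc (a := -R₁) (b := R₁)).exists_bound_of_continuousOn
    (hE'.mono (Icc_subset_Ioo (neg_lt_neg hR₁) hR₁))
  have hs : {x : ℝ | |x| < R₁} ∈ 𝓝 ρ := (isOpen_lt continuous_abs continuous_const).mem_nhds hρ₁
  have hcont : ∀ x, |x| < R₁ → Continuous fun θ => Real.cos θ • E (x * Real.cos θ) :=
    fun x hx => continuous_cos_smul_comp_mul_cos hEc (hx.trans hR₁)
  refine (intervalIntegral.hasDerivAt_integral_of_dominated_loc_of_deriv_le
    (F' := fun x θ => Real.cos θ ^ 2 • E' (x * Real.cos θ)) (bound := fun _ => C) hs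
    ?_ ((hcont ρ hρ₁).intervalIntegrable _ _) ?_ ?_ intervalIntegrable_const ?_).2
  · filter_upwards [hs] with x hx
    exact (hcont x hx).aestronglyMeasurable
  · exact ((Real.continuous_cos.pow 2).smul
      (continuous_comp_mul_cos hE' hρ)).aestronglyMeasurable
  · refine Eventually.of_forall fun θ _ x hx => ?_
    rw [norm_smul, norm_pow]
    exact (mul_le_of_le_one_left (norm_nonneg _)
      (pow_le_one₀ (norm_nonneg _) (Real.abs_cos_le_one θ))).trans
      (hC _ (Ioo_subset_Icc_self (mul_cos_mem_Ioo hx θ)))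
  · refine Eventually.of_forall fun θ _ x hx => ?_
    have hcomp := (hE _ (mul_cos_mem_Ioo (hx.trans hR₁) θ)).scomp x
      ((hasDerivAt_id x).mul_const (Real.cos θ))
    refine (hcomp.const_smul (Real.cos θ)).congr_deriv ?_
    module

theorem hasDerivAt_smul_integral_cos_smul_comp_mul_cos [CompleteSpace V]
    (hE : ∀ u ∈ Ioo (-R) R, HasDerivAt E (E' u) u) (hE' : ContinuousOn E' (Ioo (-R) R))
    (hρ : |ρ| < R) :
    HasDerivAt (fun ρ => ρ • ∫ θ in (0 : ℝ)..π, Real.cos θ • E (ρ * Real.cos θ))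
      (ρ • ∫ θ in (0 : ℝ)..π, E' (ρ * Real.cos θ)) ρ := by
  have hcont := continuous_comp_mul_cos hE' hρ
  have hcos : Continuous fun θ => Real.cos θ ^ 2 • E' (ρ * Real.cos θ) :=
    (Real.continuous_cos.pow 2).smul hcont
  have hsin : Continuous fun θ => Real.sin θ ^ 2 • E' (ρ * Real.cos θ) :=
    (Real.continuous_sin.pow 2).smul hcont
  refine ((hasDerivAt_id ρ).smul
    (hasDerivAt_integral_cos_smul_comp_mul_cos hE hE' hρ)).congr_deriv ?_
  rw [id, one_smul, integral_cos_smul_comp_mul_cos hE hE' hρ, ← smul_add,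
    ← intervalIntegral.integral_add (hcos.intervalIntegrable _ _) (hsin.intervalIntegrable _ _)]
  simp only [← add_smul, Real.cos_sq_add_sin_sq, one_smul]

end CircleIntegral

section AbelIntegral

variable {a : ℝ} {ξ : ℝ → ℝ} {t : ℝ}

/-- The Abelian integrals `J₋₁, J₀, J₁` in the coordinates `u = radial a x`, `w = √x y`, in which
the oval of `H = t` is the circle `u² + w² = t + 3 - a`. -/
def abelInt (a : ℝ) (ξ : ℝ → ℝ) (t : ℝ) : Fin 3 → ℝ :=
  (2 * (t + 3 - a)) •
    ∫ θ in (0 : ℝ)..π, Real.sin θ ^ 2 • radialDens a ξ (√(t + 3 - a) * Real.cos θ)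

theorem abs_sqrt_add_sub_lt (ht : t ∈ Ioo (a - 3) 0) : |√(t + 3 - a)| < √(3 - a) := by
  rw [abs_of_nonneg (Real.sqrt_nonneg _)]
  exact Real.sqrt_lt_sqrt (by linarith [ht.1]) (by linarith [ht.2])

theorem mulVec_intervalIntegral {m n : Type*} [Fintype m] [Fintype n] (M : Matrix m n ℝ)
    {f : ℝ → n → ℝ} (hf : Continuous f) (x y : ℝ) :
    M *ᵥ ∫ s in x..y, f s = ∫ s in x..y, M *ᵥ f s :=
  (M.mulVecLin.toContinuousLinearMap.intervalIntegral_comp_comm (hf.intervalIntegrable x y)).symm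

namespace IsRadialInv

theorem abelInt_eq (h : IsRadialInv a ξ) (ht : t ∈ Ioo (a - 3) 0) :
    abelInt a ξ t = (2 : ℝ) • √(t + 3 - a) •
      ∫ θ in (0 : ℝ)..π, Real.cos θ • radialPrim ξ (√(t + 3 - a) * Real.cos θ) := by
  rw [integral_cos_smul_comp_mul_cos (fun u hu => h.hasDerivAt_radialPrim hu)
    h.continuousOn_radialDens (abs_sqrt_add_sub_lt ht), abelInt, smul_smul, smul_smul, mul_assoc,
    Real.mul_self_sqrt (by linarith [ht.1])]

theorem hasDerivAt_abelInt (h : IsRadialInv a ξ) (ht : t ∈ Ioo (a - 3) 0) :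
    HasDerivAt (abelInt a ξ) (∫ θ in (0 : ℝ)..π, radialDens a ξ (√(t + 3 - a) * Real.cos θ)) t := by
  have hpos : 0 < t + 3 - a := by linarith [ht.1]
  have hs : √(t + 3 - a) ≠ 0 := (Real.sqrt_pos.2 hpos).ne'
  have hsqrt : HasDerivAt (fun t : ℝ => √(t + 3 - a)) (1 / (2 * √(t + 3 - a))) t :=
    (((hasDerivAt_id t).add_const 3).sub_const a).sqrt hpos.ne'
  have hcircle := hasDerivAt_smul_integral_cos_smul_comp_mul_cos
    (fun u hu => h.hasDerivAt_radialPrim hu) h.continuousOn_radialDens (abs_sqrt_add_sub_lt ht)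
  have hcomp := ((hcircle.scomp t hsqrt).const_smul (2 : ℝ)).congr_of_eventuallyEq
    (f₁ := abelInt a ξ) ?_
  · refine hcomp.congr_deriv ?_
    rw [smul_smul, smul_smul, show 2 * (1 / (2 * √(t + 3 - a))) * √(t + 3 - a) = 1 by field_simp,
      one_smul]
  · filter_upwards [Ioo_mem_nhds ht.1 ht.2] with s hs using h.abelInt_eq hs

theorem pf_radialDens (h : IsRadialInv a ξ) {u : ℝ} (hu : u ∈ Ioo (-√(3 - a)) √(3 - a)) (t : ℝ) :
    (pfConst a + t • pfLinear a) *ᵥ radialDens a ξ u =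
      pfRhs a *ᵥ ((2 * (t + 3 - a - u ^ 2)) • radialDens a ξ u) +
      !![-1 / 3, 0, 0; a - 1, 2 / 3 * a, 0; 2 - a, 1 - a, a] *ᵥ
        (u • radialPrim ξ u - (t + 3 - a - u ^ 2) • radialDens a ξ u) := by
  have hx := (h.mem_Ioo hu).1
  have hR := radialDeriv_pos h.gt_neg_one h.lt_two (Ioo_subset_Icc_self (h.mem_Ioo hu))
  have hw : t + 3 - a - u ^ 2 = t + ξ u * conic a (ξ u) := by
    rw [← h.sub_sq_eq (Ioo_subset_Icc_self hu)]; ring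
  have hu' : u = 3 / 2 * (ξ u - 1) * (a * (ξ u - 1) + 2) * (radialDeriv a (ξ u))⁻¹ := by
    rw [← h.mul_radialDeriv (Ioo_subset_Icc_self hu)]
    field_simp
  have hs := Real.sqrt_pos.2 hx
  have hsq : √(ξ u) ^ 2 = ξ u := Real.sq_sqrt hx.le
  rw [hw]
  simp only [radialDens, radialPrim, conic]
  generalize (radialDeriv a (ξ u))⁻¹ = I at *
  generalize √(ξ u) = s at *
  generalize ξ u = x at *
  subst hsq
  rw [hu']
  ext i
  fin_cases i <;>
    simp [pfConst, pfLinear, pfRhs, mulVec, dotProduct, Fin.sum_univ_three] <;>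
    field_simp <;> ring

theorem isPFSolution_abelInt (h : IsRadialInv a ξ) :
    IsPFSolution a (Ioo (a - 3) 0) (abelInt a ξ) := by
  refine isPFSolution_iff.2 fun t ht => ?_
  have hd := h.hasDerivAt_abelInt ht
  refine ⟨hd.differentiableAt, ?_⟩
  rw [hd.deriv, abelInt, RCLike.ofReal_real_eq_id, id]
  have hsq : √(t + 3 - a) ^ 2 = t + 3 - a := Real.sq_sqrt (by linarith [ht.1])
  have hρ := abs_sqrt_add_sub_lt ht
  generalize √(t + 3 - a) = ρ at *
  have hdens := continuous_comp_mul_cos h.continuousOn_radialDens hρ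
  have hsin := continuous_smul_sin_sq_smul_comp_mul_cos h.continuousOn_radialDens hρ
  have hdiff : Continuous fun θ => ρ • (Real.cos θ • radialPrim ξ (ρ * Real.cos θ) -
      ρ • Real.sin θ ^ 2 • radialDens a ξ (ρ * Real.cos θ)) :=
    ((continuous_cos_smul_comp_mul_cos h.continuousOn_radialPrim hρ).sub (hsin ρ)).const_smul ρ
  have hpf : ∀ θ, (pfConst a + t • pfLinear a) *ᵥ radialDens a ξ (ρ * Real.cos θ) =
      pfRhs a *ᵥ ((2 * (t + 3 - a)) • Real.sin θ ^ 2 • radialDens a ξ (ρ * Real.cos θ)) +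
      !![-1 / 3, 0, 0; a - 1, 2 / 3 * a, 0; 2 - a, 1 - a, a] *ᵥ
        (ρ • (Real.cos θ • radialPrim ξ (ρ * Real.cos θ) -
          ρ • Real.sin θ ^ 2 • radialDens a ξ (ρ * Real.cos θ))) := by
    intro θ
    rw [h.pf_radialDens (mul_cos_mem_Ioo hρ θ) t, mul_pow, ← hsq, Real.cos_sq']
    congr 2 <;> module
  rw [mulVec_intervalIntegral _ hdens, intervalIntegral.integral_congr fun θ _ => hpf θ,
    intervalIntegral.integral_add
      ((continuous_const.matrix_mulVec (hsin _)).intervalIntegrable _ _)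
      ((continuous_const.matrix_mulVec hdiff).intervalIntegrable _ _),
    ← mulVec_intervalIntegral _ (hsin _), ← mulVec_intervalIntegral _ hdiff,
    intervalIntegral.integral_smul, intervalIntegral.integral_smul,
    integral_cos_smul_sub_sin_sq_smul_eq_zero (fun u hu => h.hasDerivAt_radialPrim hu)
      h.continuousOn_radialDens hρ, smul_zero, mulVec_zero, add_zero]

end IsRadialInv

end AbelIntegral

section LogCoefficient

variable {a : ℝ} {ξ : ℝ → ℝ}

theorem hasDerivAt_conic (a x : ℝ) : HasDerivAt (conic a) (-(2 * a * x) + 3 * (a - 1)) x := by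
  refine ((((hasDerivAt_pow 2 x).const_mul (-a)).add
    ((hasDerivAt_id x).const_mul (3 * (a - 1)))).add_const (3 * (2 - a))).congr_deriv ?_
  ring

theorem hasDerivAt_mul_sqrt_self {f : ℝ → ℝ} {f' x : ℝ} (hf : HasDerivAt f f' x) (h0 : 0 < f x) :
    HasDerivAt (fun x => f x * √(f x)) (3 / 2 * √(f x) * f') x := by
  have := Real.sqrt_pos.2 h0
  refine (hf.mul (hf.sqrt h0.ne')).congr_deriv ?_
  field_simp
  rw [Real.sq_sqrt h0.le]
  ring

theorem pfResidue_radialPrim (a : ℝ) (ξ : ℝ → ℝ) (u : ℝ) :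
    pfResidue a (radialPrim ξ u) = 3 * (1 - a) * √(ξ u) + 2 / 3 * a * (ξ u * √(ξ u)) := by
  simp only [pfResidue_apply, pfRhs, radialPrim, mulVec, dotProduct, Fin.sum_univ_three, of_apply,
    cons_val]
  ring

theorem pfResidue_radialDens_mul_sqrt {u : ℝ} (hx : 0 < ξ u) :
    pfResidue a (radialDens a ξ u) * √(ξ u) =
      -(1 / 2) * ((-(2 * a * ξ u) + 3 * (a - 1)) * (radialDeriv a (ξ u))⁻¹) := by
  have hs := Real.sqrt_pos.2 hx
  have hsq := Real.sq_sqrt hx.le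
  simp only [pfResidue_apply, pfRhs, radialDens, mulVec, dotProduct, Fin.sum_univ_three, of_apply,
    Pi.smul_apply, smul_eq_mul, cons_val]
  generalize √(ξ u) = s at *
  rw [← hsq]
  field_simp
  ring

/-- A primitive of the integrand `√(3 - a) cos θ * pfResidue a (radialPrim ξ (√(3 - a) cos θ))`
of the limit of the residue of the Abelian integrals at `t = 0`. -/
def criticalPrim (a : ℝ) (ξ : ℝ → ℝ) (θ : ℝ) : ℝ :=
  pfResidue a (radialPrim ξ (√(3 - a) * Real.cos θ)) * (√(3 - a) * Real.sin θ) +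
    1 / 3 * (conic a (ξ (√(3 - a) * Real.cos θ)) * √(conic a (ξ (√(3 - a) * Real.cos θ))))

namespace IsRadialInv

theorem continuous_pfResidue_radialPrim (h : IsRadialInv a ξ) {X : Type*} [TopologicalSpace X]
    {u : X → ℝ} (hu : Continuous u) : Continuous fun x => pfResidue a (radialPrim ξ (u x)) := by
  have := h.continuous
  simp only [pfResidue_radialPrim]
  fun_prop

theorem mul_conic_eq (h : IsRadialInv a ξ) (θ : ℝ) :
    ξ (√(3 - a) * Real.cos θ) * conic a (ξ (√(3 - a) * Real.cos θ)) =
      (√(3 - a) * Real.sin θ) ^ 2 := by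
  have hs := Real.sqrt_nonneg (3 - a)
  have hmem : √(3 - a) * Real.cos θ ∈ Icc (-√(3 - a)) √(3 - a) :=
    ⟨by nlinarith [Real.neg_one_le_cos θ], by nlinarith [Real.cos_le_one θ]⟩
  rw [← h.sub_sq_eq hmem, mul_pow, mul_pow, Real.sin_sq,
    Real.sq_sqrt (by linarith [h.lt_two] : 0 ≤ 3 - a)]
  ring

theorem hasDerivAt_criticalPrim (h : IsRadialInv a ξ) {θ : ℝ} (hθ : θ ∈ Ioo 0 π) :
    HasDerivAt (criticalPrim a ξ)
      (√(3 - a) * (Real.cos θ * pfResidue a (radialPrim ξ (√(3 - a) * Real.cos θ)))) θ := by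
  have hs : 0 < √(3 - a) := Real.sqrt_pos.2 (by linarith [h.lt_two])
  have hsin := Real.sin_pos_of_mem_Ioo hθ
  have hcos : |Real.cos θ| < 1 := by
    rw [← sq_lt_one_iff_abs_lt_one, Real.cos_sq']; nlinarith
  have hu : √(3 - a) * Real.cos θ ∈ Ioo (-√(3 - a)) √(3 - a) := by
    rw [Set.mem_Ioo, ← abs_lt, abs_mul, abs_of_pos hs]; nlinarith
  have hmul := h.mul_conic_eq θ
  have dcos := (Real.hasDerivAt_cos θ).const_mul √(3 - a)
  have dsin := (Real.hasDerivAt_sin θ).const_mul √(3 - a)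
  have dprim := ((pfResidue a).hasFDerivAt.comp_hasDerivAt _ (h.hasDerivAt_radialPrim hu)).comp θ
    dcos
  have dconic := (hasDerivAt_conic a _).comp θ ((h.hasDerivAt hu).comp θ dcos)
  have hx := (h.mem_Ioo hu).1
  have hz : 0 < conic a (ξ (√(3 - a) * Real.cos θ)) :=
    pos_of_mul_pos_right (hmul.symm ▸ by positivity) hx.le
  have hroot : √(ξ (√(3 - a) * Real.cos θ)) * √(conic a (ξ (√(3 - a) * Real.cos θ))) =
      √(3 - a) * Real.sin θ := by
    rw [← Real.sqrt_mul hx.le, hmul, Real.sqrt_sq (by positivity)]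
  refine ((dprim.mul dsin).add
    ((hasDerivAt_mul_sqrt_self dconic hz).const_mul (1 / 3))).congr_deriv ?_
  have hdens := pfResidue_radialDens_mul_sqrt (a := a) hx
  simp only [Function.comp_apply]
  rw [mul_neg, ← hroot]
  linear_combination
    -(√(ξ (√(3 - a) * Real.cos θ)) * √(conic a (ξ (√(3 - a) * Real.cos θ))) ^ 2) * hdens

theorem continuous_criticalPrim (h : IsRadialInv a ξ) : Continuous (criticalPrim a ξ) := by
  have := h.continuous
  unfold criticalPrim conic
  exact ((h.continuous_pfResidue_radialPrim (by fun_prop)).mul (by fun_prop)).add (by fun_prop)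

theorem criticalPrim_zero (h : IsRadialInv a ξ) : criticalPrim a ξ 0 = 0 := by
  have hs : 0 < √(3 - a) := Real.sqrt_pos.2 (by linarith [h.lt_two])
  have hξ : ξ √(3 - a) ≠ 0 := fun e => by
    have := h.right_inv _ (h.Icc_subset (right_mem_Icc.2 (by linarith)))
    rw [e, radial_zero] at this
    linarith
  have hconic : conic a (ξ √(3 - a)) = 0 := by simpa [hξ] using h.mul_conic_eq 0
  simp [criticalPrim, hconic]

theorem criticalPrim_pi (h : IsRadialInv a ξ) :
    criticalPrim a ξ π = (2 - a) * √(3 * (2 - a)) := by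
  have hξ : ξ (-√(3 - a)) = 0 := by
    rw [← radial_zero]
    exact h.left_inv 0 (by norm_num)
  simp only [criticalPrim, Real.cos_pi, Real.sin_pi, mul_neg_one, hξ, conic]
  ring_nf

theorem integral_pfResidue_radialPrim (h : IsRadialInv a ξ) :
    √(3 - a) * ∫ θ in (0 : ℝ)..π, Real.cos θ * pfResidue a (radialPrim ξ (√(3 - a) * Real.cos θ)) =
      (2 - a) * √(3 * (2 - a)) := by
  rw [← intervalIntegral.integral_const_mul,
    intervalIntegral.integral_eq_sub_of_hasDerivAt_of_le Real.pi_pos.le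
      h.continuous_criticalPrim.continuousOn (fun θ hθ => h.hasDerivAt_criticalPrim hθ)
      ((continuous_const.mul (Real.continuous_cos.mul
        (h.continuous_pfResidue_radialPrim (by fun_prop)))).intervalIntegrable _ _),
    h.criticalPrim_pi, h.criticalPrim_zero, sub_zero]

theorem pfResidue_abelInt (h : IsRadialInv a ξ) {t : ℝ} (ht : t ∈ Ioo (a - 3) 0) :
    pfResidue a (abelInt a ξ t) = 2 * (√(t + 3 - a) *
      ∫ θ in (0 : ℝ)..π, Real.cos θ * pfResidue a (radialPrim ξ (√(t + 3 - a) * Real.cos θ))) := by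
  have hcont := continuous_cos_smul_comp_mul_cos h.continuousOn_radialPrim (abs_sqrt_add_sub_lt ht)
  rw [h.abelInt_eq ht, map_smul, map_smul, smul_eq_mul, smul_eq_mul,
    ← (pfResidue a).intervalIntegral_comp_comm (hcont.intervalIntegrable 0 π)]
  simp only [map_smul, smul_eq_mul]

theorem tendsto_pfResidue_abelInt (h : IsRadialInv a ξ) :
    Tendsto (fun t => pfResidue a (abelInt a ξ t)) (𝓝[<] 0)
      (𝓝 (2 * ((2 - a) * √(3 * (2 - a))))) := by
  have hcont : Continuous fun t : ℝ => 2 * (√(t + 3 - a) * ∫ θ in (0 : ℝ)..π,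
      Real.cos θ * pfResidue a (radialPrim ξ (√(t + 3 - a) * Real.cos θ))) := by
    refine continuous_const.mul (Continuous.mul (by fun_prop)
      (intervalIntegral.continuous_parametric_intervalIntegral_of_continuous' ?_ 0 π))
    exact (Real.continuous_cos.comp continuous_snd).mul
      (h.continuous_pfResidue_radialPrim (by fun_prop))
  have hlim := (hcont.tendsto 0).mono_left (nhdsWithin_le_nhds (s := Iio 0))
  rw [zero_add, h.integral_pfResidue_radialPrim] at hlim
  refine hlim.congr' ?_
  filter_upwards [Ioo_mem_nhdsLT (by linarith [h.lt_two] : a - 3 < 0)] with t ht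
  exact (h.pfResidue_abelInt ht).symm

theorem exists_abelInt_expansion (h : IsRadialInv a ξ) {r : ℝ} (hr : IsPFRadius ℝ a r)
    (hr3 : r ≤ 3 - a) :
    ∃ d : ℕ → Fin 3 → ℝ, VecSeriesConverges d r ∧ ∀ t ∈ Ioo (-r) 0, abelInt a ξ t =
      (-2 * √(3 * (2 - a)) * Real.log t) • vecSeries (holCoeff a) t + vecSeries d t := by
  have ha1 := h.gt_neg_one.ne'
  have ha2 := h.lt_two.ne
  have ha3 : a ≠ 3 := (h.lt_two.trans (by norm_num)).ne
  have hsol : IsPFSolution a (Ioo (-r) 0) (abelInt a ξ) := fun t ht =>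
    h.isPFSolution_abelInt t ⟨by linarith [ht.1], ht.2⟩
  obtain ⟨k, d, hd, hkd, hJ⟩ := hr.exists_log_expansion ha1 ha2 ha3 hsol
  have hlim := tendsto_pfResidue_log_expansion hr.hol hd hr.pos
    (isPFCoeff_holCoeff ha1 ha2 ha3).pfResidue_eq_zero k
  have hres : pfResidue a (d 0) = 2 * ((2 - a) * √(3 * (2 - a))) := by
    refine tendsto_nhds_unique (hlim.congr' ?_) h.tendsto_pfResidue_abelInt
    filter_upwards [Ioo_mem_nhdsLT (neg_lt_zero.2 hr.pos)] with t ht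
    rw [hJ t ht]
  have hk : k = -2 * √(3 * (2 - a)) :=
    mul_right_cancel₀ (sub_ne_zero.2 ha2) (by linear_combination hres - hkd)
  exact ⟨d, hd, fun t ht => hk ▸ hJ t ht⟩

end IsRadialInv

end LogCoefficient

section CircleParametrization

theorem exists_angle_of_sq_add_sq_eq {x y ρ : ℝ} (hρ : 0 ≤ ρ) (h : x ^ 2 + y ^ 2 = ρ ^ 2) :
    ∃ θ, x = ρ * Real.cos θ ∧ y = -(ρ * Real.sin θ) := by
  have hnorm : ‖(⟨x, -y⟩ : ℂ)‖ = ρ := by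
    rw [Complex.norm_eq_sqrt_sq_add_sq, neg_sq, h, Real.sqrt_sq hρ]
  refine ⟨Complex.arg ⟨x, -y⟩, ?_, ?_⟩
  · rw [← hnorm, Complex.norm_mul_cos_arg]
  · rw [← hnorm, Complex.norm_mul_sin_arg, neg_neg]

theorem angle_eq_of_mul_cos_eq_of_mul_sin_eq {ρ θ φ : ℝ} (hρ : ρ ≠ 0)
    (hcos : ρ * Real.cos θ = ρ * Real.cos φ) (hsin : ρ * Real.sin θ = ρ * Real.sin φ) :
    (θ : Real.Angle) = φ :=
  Real.Angle.cos_sin_inj (mul_left_cancel₀ hρ hcos) (mul_left_cancel₀ hρ hsin)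

theorem eq_mul_cos_and_eq_neg_mul_sin_of_rotation {u w μ ψ : ℝ → ℝ} {ρ : ℝ}
    (hu : ∀ s, HasDerivAt u (μ s * w s) s) (hw : ∀ s, HasDerivAt w (-(μ s * u s)) s)
    (hψ : ∀ s, HasDerivAt ψ (μ s) s) (hu0 : u 0 = ρ * Real.cos (ψ 0))
    (hw0 : w 0 = -(ρ * Real.sin (ψ 0))) (s : ℝ) :
    u s = ρ * Real.cos (ψ s) ∧ w s = -(ρ * Real.sin (ψ s)) := by
  have hA : ∀ s, HasDerivAt (fun s => u s * Real.cos (ψ s) - w s * Real.sin (ψ s)) 0 s :=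
    fun s => (((hu s).mul (hψ s).cos).sub ((hw s).mul (hψ s).sin)).congr_deriv (by ring)
  have hB : ∀ s, HasDerivAt (fun s => u s * Real.sin (ψ s) + w s * Real.cos (ψ s)) 0 s :=
    fun s => (((hu s).mul (hψ s).sin).add ((hw s).mul (hψ s).cos)).congr_deriv (by ring)
  have hAs : u s * Real.cos (ψ s) - w s * Real.sin (ψ s) = ρ := by
    rw [is_const_of_deriv_eq_zero (fun s => (hA s).differentiableAt) (fun s => (hA s).deriv) s 0,
      hu0, hw0]
    linear_combination ρ * Real.sin_sq_add_cos_sq (ψ 0)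
  have hBs : u s * Real.sin (ψ s) + w s * Real.cos (ψ s) = 0 := by
    rw [is_const_of_deriv_eq_zero (fun s => (hB s).differentiableAt) (fun s => (hB s).deriv) s 0,
      hu0, hw0]
    ring
  constructor
  · linear_combination Real.cos (ψ s) * hAs + Real.sin (ψ s) * hBs -
      u s * Real.sin_sq_add_cos_sq (ψ s)
  · linear_combination -Real.sin (ψ s) * hAs + Real.cos (ψ s) * hBs -
      w s * Real.sin_sq_add_cos_sq (ψ s)

theorem exists_angle_of_contDiff {u w : ℝ → ℝ} {ρ : ℝ} (hρ : 0 < ρ) (hu : ContDiff ℝ 1 u)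
    (hw : ContDiff ℝ 1 w) (hcirc : ∀ s, u s ^ 2 + w s ^ 2 = ρ ^ 2) :
    ∃ ψ μ : ℝ → ℝ, Continuous μ ∧ (∀ s, HasDerivAt ψ (μ s) s) ∧
      (∀ s, deriv u s * w s - deriv w s * u s = ρ ^ 2 * μ s) ∧
      (∀ s, u s = ρ * Real.cos (ψ s)) ∧ ∀ s, w s = -(ρ * Real.sin (ψ s)) := by
  have hu' : ∀ s, HasDerivAt u (deriv u s) s :=
    fun s => (hu.differentiable one_ne_zero s).hasDerivAt
  have hw' : ∀ s, HasDerivAt w (deriv w s) s :=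
    fun s => (hw.differentiable one_ne_zero s).hasDerivAt
  set μ : ℝ → ℝ := fun s => (deriv u s * w s - deriv w s * u s) / ρ ^ 2 with hμ
  have hμc : Continuous μ :=
    (((hu.continuous_deriv le_rfl).mul hw.continuous).sub
      ((hw.continuous_deriv le_rfl).mul hu.continuous)).div_const _
  have horth : ∀ s, u s * deriv u s + w s * deriv w s = 0 := fun s => by
    have h := ((hu' s).pow 2).add ((hw' s).pow 2)
    have := h.unique ((hasDerivAt_const s (ρ ^ 2)).congr_of_eventuallyEq (.of_forall hcirc))
    simp only [Nat.cast_ofNat, Nat.add_one_sub_one, pow_one] at this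
    linarith
  have hρμ : ∀ s, deriv u s * w s - deriv w s * u s = ρ ^ 2 * μ s := fun s => by
    simp only [hμ]
    field_simp
  have hμw : ∀ s, deriv u s = μ s * w s := fun s => mul_left_cancel₀ (pow_pos hρ 2).ne' <| by
    linear_combination -deriv u s * hcirc s + u s * horth s + w s * hρμ s
  have hμu : ∀ s, deriv w s = -(μ s * u s) := fun s => mul_left_cancel₀ (pow_pos hρ 2).ne' <| by
    linear_combination -deriv w s * hcirc s + w s * horth s - u s * hρμ s
  obtain ⟨ψ₀, hu0, hw0⟩ := exists_angle_of_sq_add_sq_eq hρ.le (hcirc 0)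
  have hψ : ∀ s, HasDerivAt (fun s => ψ₀ + ∫ x in (0 : ℝ)..s, μ x) (μ s) s := fun s =>
    ((hμc.integral_hasStrictDerivAt 0 s).hasDerivAt).const_add ψ₀
  have hpolar := eq_mul_cos_and_eq_neg_mul_sin_of_rotation (fun s => hμw s ▸ hu' s)
    (fun s => hμu s ▸ hw' s) hψ (by simpa using hu0) (by simpa using hw0)
  exact ⟨_, μ, hμc, hψ, hρμ, fun s => (hpolar s).1, fun s => (hpolar s).2⟩

theorem eq_add_two_pi_of_angle_eq {ψ : ℝ → ℝ} {x y : ℝ} (hxy : x ≤ y)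
    (hψ : ContinuousOn ψ (Icc x y)) (hlt : ψ x < ψ y) (heq : (ψ y : Real.Angle) = ψ x)
    (hne : ∀ s ∈ Ioo x y, (ψ s : Real.Angle) ≠ ψ x) : ψ y = ψ x + 2 * π := by
  obtain ⟨n, hn⟩ := Real.Angle.angle_eq_iff_two_pi_dvd_sub.1 heq
  have hn_pos : 0 < n := by
    have : 0 < 2 * π * n := hn ▸ sub_pos.2 hlt
    exact_mod_cast pos_of_mul_pos_right this Real.two_pi_pos.le
  have hn_le : n ≤ 1 := by
    by_contra! h
    have h2 : (2 : ℝ) ≤ n := by exact_mod_cast h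
    obtain ⟨s, hs, hψs⟩ := intermediate_value_Ioo hxy hψ
      (⟨by linarith [Real.pi_pos], by nlinarith [Real.pi_pos]⟩ : ψ x + 2 * π ∈ Ioo (ψ x) (ψ y))
    exact hne s hs (by rw [hψs, Real.Angle.coe_add, Real.Angle.coe_two_pi, add_zero])
  rw [show n = 1 by lia, Int.cast_one] at hn
  linarith

theorem intervalIntegral_add_two_pi_eq_two_mul {G : ℝ → ℝ} (hG : Continuous G)
    (hper : Function.Periodic G (2 * π)) (heven : Function.Even G) (x : ℝ) :
    ∫ θ in x..(x + 2 * π), G θ = 2 * ∫ θ in (0 : ℝ)..π, G θ := by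
  have hleft : ∫ θ in (-π)..0, G θ = ∫ θ in (0 : ℝ)..π, G θ := by
    simpa [heven _] using intervalIntegral.integral_comp_neg (a := -π) (b := 0) G
  rw [hper.intervalIntegral_add_eq x (-π), show -π + 2 * π = π by ring,
    ← intervalIntegral.integral_add_adjacent_intervals (hG.intervalIntegrable (-π) 0)
      (hG.intervalIntegrable 0 π), hleft, two_mul]

end CircleParametrization

section CircleCoordinates

variable {a t : ℝ}

theorem hamField_eq (a : ℝ) (p : ℝ × ℝ) :
    hamField a p = (2 * p.1 * p.2, -(p.2 ^ 2 + 3 * (p.1 - 1) * (a * (p.1 - 1) + 2))) := by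
  have hdy : HasDerivAt (fun y => hamH a p.1 y) (2 * p.1 * p.2) p.2 := by
    refine ((((hasDerivAt_pow 2 p.2).add_const (a * p.1 ^ 2)).sub_const
      (3 * (a - 1) * p.1)).add_const (3 * (a - 2)) |>.const_mul p.1).congr_deriv ?_
    ring
  have hdx : HasDerivAt (fun x => hamH a x p.2)
      (p.2 ^ 2 + 3 * (p.1 - 1) * (a * (p.1 - 1) + 2)) p.1 := by
    refine ((hasDerivAt_id p.1).mul (((((hasDerivAt_pow 2 p.1).const_mul a).const_add
      (p.2 ^ 2)).sub ((hasDerivAt_id p.1).const_mul (3 * (a - 1)))).add_const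
      (3 * (a - 2)))).congr_deriv ?_
    simp only [id_eq, Pi.sub_apply]
    ring
  rw [hamField, hdy.deriv, hdx.deriv]

/-- The coordinates `u = radial a x`, `w = √x y` on the strip `0 < x < 3`, in which the level
curves `H = t` are the circles `u² + w² = t + 3 - a`. -/
def circleCoord (a : ℝ) (p : ℝ × ℝ) : ℝ × ℝ := (radial a p.1, √p.1 * p.2)

/-- The Hamiltonian vector field is `angularSpeed a` times the rotation field `(w, -u)` in the
coordinates `circleCoord a`. -/
def angularSpeed (a : ℝ) (p : ℝ × ℝ) : ℝ := 2 * √p.1 * radialDeriv a p.1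

theorem angularSpeed_pos (ha : -1 < a) (ha' : a < 2) {p : ℝ × ℝ} (hp : p.1 ∈ Ioo 0 3) :
    0 < angularSpeed a p :=
  mul_pos (mul_pos two_pos (Real.sqrt_pos.2 hp.1))
    (radialDeriv_pos ha ha' (Ioo_subset_Icc_self hp))

theorem circleCoord_sq_add_sq (ha : -1 < a) (ha' : a < 2) {p : ℝ × ℝ} (hp : p.1 ∈ Ioo 0 3) :
    (circleCoord a p).1 ^ 2 + (circleCoord a p).2 ^ 2 = hamH a p.1 p.2 + 3 - a := by
  rw [hamH_eq ha ha' (Ioo_subset_Icc_self hp), circleCoord, mul_pow, Real.sq_sqrt hp.1.le]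
  ring

theorem injOn_circleCoord (ha : -1 < a) (ha' : a < 2) :
    InjOn (circleCoord a) {p | p.1 ∈ Ioo 0 3} := by
  rintro ⟨x, y⟩ hp ⟨x', y'⟩ hp' h
  obtain ⟨hu, hw⟩ := Prod.ext_iff.1 h
  obtain rfl : x = x' := (strictMonoOn_radial ha ha').injOn (Ioo_subset_Icc_self hp)
    (Ioo_subset_Icc_self hp') hu
  exact Prod.ext rfl (mul_left_cancel₀ (Real.sqrt_pos.2 hp.1).ne' hw)

theorem hasDerivAt_circleCoord_fst (ha : -1 < a) (ha' : a < 2) {γ : ℝ → ℝ × ℝ} {v : ℝ × ℝ} {s : ℝ}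
    (hs : (γ s).1 ∈ Ioo 0 3) (hγ : HasDerivAt γ v s) :
    HasDerivAt (fun s => (circleCoord a (γ s)).1) (radialDeriv a (γ s).1 * v.1) s :=
  HasDerivAt.comp (h₂ := radial a) (h := fun s => (γ s).1) s
    (hasDerivAt_radial ha ha' (Ioo_subset_Icc_self hs)) hγ.fst

theorem hasDerivAt_circleCoord_fst_of_hamField (ha : -1 < a) (ha' : a < 2) {γ : ℝ → ℝ × ℝ}
    {s l : ℝ} (hs : (γ s).1 ∈ Ioo 0 3) (hγ : HasDerivAt γ (l • hamField a (γ s)) s) :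
    HasDerivAt (fun s => (circleCoord a (γ s)).1)
      (l * angularSpeed a (γ s) * (circleCoord a (γ s)).2) s := by
  refine (hasDerivAt_circleCoord_fst ha ha' hs hγ).congr_deriv ?_
  simp only [hamField_eq, circleCoord, angularSpeed, Prod.smul_mk, smul_eq_mul]
  linear_combination
    (-2 * l * radialDeriv a (γ s).1 * (γ s).2) * Real.sq_sqrt hs.1.le

theorem hasDerivAt_circleCoord_snd_of_hamField (ha : -1 < a) (ha' : a < 2) {γ : ℝ → ℝ × ℝ}
    {s l : ℝ} (hs : (γ s).1 ∈ Ioo 0 3) (hγ : HasDerivAt γ (l • hamField a (γ s)) s) :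
    HasDerivAt (fun s => (circleCoord a (γ s)).2)
      (-(l * angularSpeed a (γ s) * (circleCoord a (γ s)).1)) s := by
  have hx : HasDerivAt (fun s => (γ s).1) (l • hamField a (γ s)).1 s := hγ.fst
  have hy : HasDerivAt (fun s => (γ s).2) (l • hamField a (γ s)).2 s := hγ.snd
  refine ((hx.sqrt hs.1.ne').mul hy).congr_deriv ?_
  have hradial := radial_mul_radialDeriv ha ha' (Ioo_subset_Icc_self hs)
  have hsqrt : (γ s).1 / √(γ s).1 = √(γ s).1 := Real.div_sqrt
  simp only [hamField_eq, circleCoord, angularSpeed, Prod.smul_mk, smul_eq_mul]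
  linear_combination (2 * l * √(γ s).1) * hradial + l * (γ s).2 ^ 2 * hsqrt

end CircleCoordinates

namespace IsOval

variable {a t : ℝ} {γ : ℝ → ℝ × ℝ}

theorem hasDerivAt (hγ : IsOval a t γ) (s : ℝ) : HasDerivAt γ (deriv γ s) s :=
  (hγ.contDiff.differentiable one_ne_zero s).hasDerivAt

theorem exists_fst_eq_one (hγ : IsOval a t γ) : ∃ s, (γ s).1 = 1 := by
  by_contra! hne
  have hline : range (fun y : ℝ => ((1, y) : ℝ × ℝ)) ⊆ (range γ)ᶜ := by
    rintro _ ⟨y, rfl⟩ ⟨s, hs⟩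
    exact hne s (by rw [hs])
  have hsub := (isPreconnected_range (by fun_prop)).subset_connectedComponentIn
    (x := ((1, 0) : ℝ × ℝ)) ⟨0, rfl⟩ hline
  obtain ⟨C, hC⟩ := (hγ.surrounds.subset hsub).exists_norm_le
  have hle := (norm_snd_le ((1, |C| + 1) : ℝ × ℝ)).trans (hC _ ⟨_, rfl⟩)
  rw [Real.norm_of_nonneg (by positivity)] at hle
  linarith [le_abs_self C]

theorem fst_mem_Ioo (hγ : IsOval a t γ) (ha : -1 < a) (ht : t < 0) (s : ℝ) :
    (γ s).1 ∈ Ioo (0 : ℝ) 3 := by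
  have hcont : Continuous fun s => (γ s).1 := continuous_fst.comp hγ.contDiff.continuous
  obtain ⟨s₁, h₁⟩ := hγ.exists_fst_eq_one
  constructor <;> by_contra! hs
  · obtain ⟨x, hx : (γ x).1 = 0⟩ := mem_range_of_exists_le_of_exists_ge hcont ⟨s, hs⟩
      ⟨s₁, by rw [h₁]; exact zero_le_one⟩
    have := hγ.level x
    rw [hx, hamH] at this
    linarith
  · obtain ⟨x, hx : (γ x).1 = 3⟩ := mem_range_of_exists_le_of_exists_ge hcont
      ⟨s₁, by rw [h₁]; norm_num⟩ ⟨s, hs⟩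
    have := hγ.level x
    rw [hx, hamH] at this
    nlinarith [sq_nonneg (γ x).2]

theorem contDiff_circleCoord (hγ : IsOval a t γ) (ha : -1 < a) (ha' : a < 2) (ht : t < 0) :
    ContDiff ℝ 1 fun s => circleCoord a (γ s) := by
  have hx : ContDiff ℝ 1 fun s => (γ s).1 := hγ.contDiff.fst
  have hx1 : ContDiff ℝ 1 fun s => (γ s).1 - 1 := hx.sub contDiff_const
  refine (hx1.mul (((contDiff_const.mul hx1).add contDiff_const).sqrt fun s => ?_)).prodMk
    ((hx.sqrt fun s => (hγ.fst_mem_Ioo ha ht s).1.ne').mul hγ.contDiff.snd)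
  linarith [neg_two_lt_mul ha ha' (Ioo_subset_Icc_self (hγ.fst_mem_Ioo ha ht s))]

theorem deriv_circleCoord_pos (hγ : IsOval a t γ) (ha : -1 < a) (ha' : a < 2)
    (ht : t ∈ Ioo (a - 3) 0) (s : ℝ) :
    0 < deriv (fun s => (circleCoord a (γ s)).1) s * (circleCoord a (γ s)).2 -
      deriv (fun s => (circleCoord a (γ s)).2) s * (circleCoord a (γ s)).1 := by
  have hmem := hγ.fst_mem_Ioo ha ht.2 s
  obtain ⟨l, hl, hlγ⟩ := hγ.oriented s
  have hd := hlγ ▸ hγ.hasDerivAt s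
  rw [(hasDerivAt_circleCoord_fst_of_hamField ha ha' hmem hd).deriv,
    (hasDerivAt_circleCoord_snd_of_hamField ha ha' hmem hd).deriv]
  have hcirc := circleCoord_sq_add_sq ha ha' hmem
  rw [hγ.level] at hcirc
  have hpos : 0 < l * angularSpeed a (γ s) * (t + 3 - a) :=
    mul_pos (mul_pos hl (angularSpeed_pos ha ha' hmem)) (by linarith [ht.1])
  rw [← hcirc] at hpos
  linarith

theorem exists_angle (hγ : IsOval a t γ) (ha : -1 < a) (ha' : a < 2) (ht : t ∈ Ioo (a - 3) 0) :
    ∃ ψ μ : ℝ → ℝ, Continuous μ ∧ (∀ s, HasDerivAt ψ (μ s) s) ∧ ψ 1 = ψ 0 + 2 * π ∧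
      ∀ s, circleCoord a (γ s) =
        (√(t + 3 - a) * Real.cos (ψ s), -(√(t + 3 - a) * Real.sin (ψ s))) := by
  have hpos : 0 < t + 3 - a := by linarith [ht.1]
  have hρ := Real.sqrt_pos.2 hpos
  have hmem := hγ.fst_mem_Ioo ha ht.2
  have hc := hγ.contDiff_circleCoord ha ha' ht.2
  obtain ⟨ψ, μ, hμ, hψ, hρμ, hu, hw⟩ := exists_angle_of_contDiff hρ hc.fst hc.snd fun s => by
    rw [circleCoord_sq_add_sq ha ha' (hmem s), hγ.level, Real.sq_sqrt hpos.le]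
  refine ⟨ψ, μ, hμ, hψ, ?_, fun s => Prod.ext (hu s) (hw s)⟩
  have hψmono : StrictMono ψ := strictMono_of_deriv_pos fun s => by
    rw [(hψ s).deriv]
    exact pos_of_mul_pos_right (hρμ s ▸ hγ.deriv_circleCoord_pos ha ha' ht s) (sq_nonneg _)
  refine eq_add_two_pi_of_angle_eq zero_le_one (fun s _ => (hψ s).continuousAt.continuousWithinAt)
    (hψmono one_pos) ?_ fun s hs hψs => ?_
  · have hγ1 : γ 1 = γ 0 := by simpa using hγ.periodic 0
    refine angle_eq_of_mul_cos_eq_of_mul_sin_eq hρ.ne' ?_ (neg_injective ?_)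
    · rw [← hu, ← hu, hγ1]
    · rw [← hw, ← hw, hγ1]
  · have hγs : γ s = γ 0 := injOn_circleCoord ha ha' (hmem s) (hmem 0) <| Prod.ext
      (by rw [hu, hu, ← Real.Angle.cos_coe, hψs, Real.Angle.cos_coe])
      (by rw [hw, hw, ← Real.Angle.sin_coe, hψs, Real.Angle.sin_coe])
    exact hs.1.ne' (hγ.injOn (Ioo_subset_Ico_self hs) ⟨le_rfl, one_pos⟩ hγs)

end IsOval

section OvalIntegral

variable {a t : ℝ} {ξ : ℝ → ℝ} {γ : ℝ → ℝ × ℝ}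

theorem radialDens_apply (a : ℝ) (ξ : ℝ → ℝ) (u : ℝ) (k : Fin 3) :
    radialDens a ξ u k = ξ u ^ ((k : ℤ) - 1) / √(ξ u) * (radialDeriv a (ξ u))⁻¹ := by
  simp only [radialDens, Pi.smul_apply, smul_eq_mul]
  rw [mul_comm]
  congr 1
  fin_cases k
  · simp [div_eq_mul_inv, mul_comm]
  · simp
  · simp [Real.div_sqrt]

namespace IsRadialInv

theorem abelInt_apply (h : IsRadialInv a ξ) (ht : t ∈ Ioo (a - 3) 0) (k : Fin 3) :
    abelInt a ξ t k = 2 * ∫ θ in (0 : ℝ)..π,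
      radialDens a ξ (√(t + 3 - a) * Real.cos θ) k * (√(t + 3 - a) * Real.sin θ) ^ 2 := by
  have hcont : Continuous fun θ =>
      Real.sin θ ^ 2 • radialDens a ξ (√(t + 3 - a) * Real.cos θ) :=
    (Real.continuous_sin.pow 2).smul
      (continuous_comp_mul_cos h.continuousOn_radialDens (abs_sqrt_add_sub_lt ht))
  have hproj := (ContinuousLinearMap.proj (R := ℝ) (φ := fun _ : Fin 3 => ℝ)
    k).intervalIntegral_comp_comm (μ := MeasureTheory.volume) (hcont.intervalIntegrable 0 π)
  simp only [ContinuousLinearMap.proj_apply, Pi.smul_apply, smul_eq_mul] at hproj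
  have hsq : √(t + 3 - a) ^ 2 = t + 3 - a := Real.sq_sqrt (by linarith [ht.1])
  rw [abelInt, Pi.smul_apply, ← hproj, smul_eq_mul, mul_assoc,
    ← intervalIntegral.integral_const_mul]
  congr 2
  ext θ
  rw [mul_pow, hsq]
  ring

theorem oval_integrand_eq (h : IsRadialInv a ξ) {s ρ ψ μ : ℝ} (hmem : (γ s).1 ∈ Ioo 0 3)
    (hangle : circleCoord a (γ s) = (ρ * Real.cos ψ, -(ρ * Real.sin ψ)))
    (hμ : radialDeriv a (γ s).1 * (deriv γ s).1 = -(ρ * Real.sin ψ) * μ) (k : Fin 3) :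
    (γ s).1 ^ ((k : ℤ) - 1) * (γ s).2 * (deriv γ s).1 =
      radialDens a ξ (ρ * Real.cos ψ) k * (ρ * Real.sin ψ) ^ 2 * μ := by
  obtain ⟨hu, hw⟩ := Prod.ext_iff.1 hangle
  simp only [circleCoord] at hu hw
  have hξ : ξ (ρ * Real.cos ψ) = (γ s).1 := by
    rw [← hu, h.left_inv _ (Ioo_subset_Icc_self hmem)]
  have hR := (radialDeriv_pos h.gt_neg_one h.lt_two (Ioo_subset_Icc_self hmem)).ne'
  have hs := (Real.sqrt_pos.2 hmem.1).ne'
  rw [radialDens_apply, hξ, eq_div_of_mul_eq hs ((mul_comm _ _).trans hw),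
    eq_div_of_mul_eq hR ((mul_comm _ _).trans hμ)]
  ring

theorem ovalIntegral_eq_abelInt (h : IsRadialInv a ξ) (ht : t ∈ Ioo (a - 3) 0)
    (hγ : IsOval a t γ) (k : Fin 3) : ovalIntegral γ ((k : ℤ) - 1) = abelInt a ξ t k := by
  obtain ⟨ψ, μ, hμ, hψ, hψ1, hangle⟩ := hγ.exists_angle h.gt_neg_one h.lt_two ht
  have hmem := hγ.fst_mem_Ioo h.gt_neg_one ht.2
  have hρ := abs_sqrt_add_sub_lt ht
  rw [h.abelInt_apply ht]
  generalize √(t + 3 - a) = ρ at *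
  set G : ℝ → ℝ := fun θ => radialDens a ξ (ρ * Real.cos θ) k * (ρ * Real.sin θ) ^ 2 with hG
  have hGc : Continuous G :=
    ((continuous_apply k).comp (continuous_comp_mul_cos h.continuousOn_radialDens hρ)).mul
      (by fun_prop)
  have hfst : ∀ s, radialDeriv a (γ s).1 * (deriv γ s).1 = -(ρ * Real.sin (ψ s)) * μ s := by
    intro s
    have hu := hasDerivAt_circleCoord_fst h.gt_neg_one h.lt_two (hmem s) (hγ.hasDerivAt s)
    simp only [hangle] at hu
    rw [hu.unique ((hψ s).cos.const_mul ρ)]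
    ring
  calc ovalIntegral γ ((k : ℤ) - 1) = ∫ s in (0 : ℝ)..1, (G ∘ ψ) s * μ s :=
        intervalIntegral.integral_congr fun s _ =>
          h.oval_integrand_eq (hmem s) (hangle s) (hfst s) k
    _ = ∫ θ in ψ 0..(ψ 0 + 2 * π), G θ := by
        rw [intervalIntegral.integral_comp_mul_deriv (fun s _ => hψ s) hμ.continuousOn hGc, hψ1]
    _ = 2 * ∫ θ in (0 : ℝ)..π, G θ :=
        intervalIntegral_add_two_pi_eq_two_mul hGc
          (fun θ => by simp only [hG, Real.cos_add_two_pi, Real.sin_add_two_pi])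
          (fun θ => by simp only [hG, Real.cos_neg, Real.sin_neg, mul_neg, neg_sq]) _

end IsRadialInv

end OvalIntegral

section OvalCurve

variable {a t ρ : ℝ} {ξ : ℝ → ℝ}

/-- The parametrization of the oval of `H = ρ² - 3 + a` by the (clockwise) angle in the plane of
the coordinates `circleCoord a`. -/
def ovalCurve (ξ : ℝ → ℝ) (ρ s : ℝ) : ℝ × ℝ :=
  (ξ (ρ * Real.cos (2 * π * s)),
    -(ρ * Real.sin (2 * π * s)) / √(ξ (ρ * Real.cos (2 * π * s))))

theorem periodic_ovalCurve (ξ : ℝ → ℝ) (ρ : ℝ) : Function.Periodic (ovalCurve ξ ρ) 1 := fun s => by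
  simp only [ovalCurve, mul_add, mul_one, Real.cos_add_two_pi, Real.sin_add_two_pi]

namespace IsRadialInv

theorem ovalCurve_fst_mem_Ioo (h : IsRadialInv a ξ) (hρ : |ρ| < √(3 - a)) (s : ℝ) :
    (ovalCurve ξ ρ s).1 ∈ Ioo (0 : ℝ) 3 :=
  h.mem_Ioo (mul_cos_mem_Ioo hρ _)

theorem circleCoord_ovalCurve (h : IsRadialInv a ξ) (hρ : |ρ| < √(3 - a)) (s : ℝ) :
    circleCoord a (ovalCurve ξ ρ s) =
      (ρ * Real.cos (2 * π * s), -(ρ * Real.sin (2 * π * s))) :=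
  Prod.ext (h.right_inv _ (h.Icc_subset (Ioo_subset_Icc_self (mul_cos_mem_Ioo hρ _))))
    (mul_div_cancel₀ _ (Real.sqrt_pos.2 (h.ovalCurve_fst_mem_Ioo hρ s).1).ne')

theorem hamH_ovalCurve (h : IsRadialInv a ξ) (hρ : |ρ| < √(3 - a)) (s : ℝ) :
    hamH a (ovalCurve ξ ρ s).1 (ovalCurve ξ ρ s).2 = ρ ^ 2 - 3 + a := by
  have hcirc := circleCoord_sq_add_sq h.gt_neg_one h.lt_two (h.ovalCurve_fst_mem_Ioo hρ s)
  rw [h.circleCoord_ovalCurve hρ] at hcirc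
  linear_combination -hcirc + ρ ^ 2 * Real.sin_sq_add_cos_sq (2 * π * s)

theorem hasDerivAt_ovalCurve (h : IsRadialInv a ξ) (hρ : |ρ| < √(3 - a)) (s : ℝ) :
    HasDerivAt (ovalCurve ξ ρ)
      ((2 * π / angularSpeed a (ovalCurve ξ ρ s)) • hamField a (ovalCurve ξ ρ s)) s := by
  have hu := mul_cos_mem_Ioo hρ (2 * π * s)
  have hx := (h.mem_Ioo hu).1
  have hR := radialDeriv_pos h.gt_neg_one h.lt_two (Ioo_subset_Icc_self (h.mem_Ioo hu))
  have hm := h.mul_radialDeriv (Ioo_subset_Icc_self hu)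
  have hs := Real.sqrt_pos.2 hx
  have hsq : √(ξ (ρ * Real.cos (2 * π * s))) ^ 2 = ξ (ρ * Real.cos (2 * π * s)) :=
    Real.sq_sqrt hx.le
  have hlin : HasDerivAt (fun s : ℝ => 2 * π * s) (2 * π) s := by
    simpa using (hasDerivAt_id s).const_mul (2 * π)
  have hfst := (h.hasDerivAt hu).comp s (hlin.cos.const_mul ρ)
  have hsnd := (hlin.sin.const_mul ρ).neg.div (hfst.sqrt hx.ne') hs.ne'
  refine (hfst.prodMk hsnd).congr_deriv ?_
  rw [hamField_eq]
  simp only [ovalCurve, angularSpeed, Prod.smul_mk, smul_eq_mul, Function.comp, Pi.neg_apply]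
  rw [show ∀ x, 3 * (x - 1) * (a * (x - 1) + 2) = 2 * (3 / 2 * (x - 1) * (a * (x - 1) + 2)) from
    fun x => by ring, ← hm]
  generalize radialDeriv a (ξ (ρ * Real.cos (2 * π * s))) = R at *
  generalize √(ξ (ρ * Real.cos (2 * π * s))) = v at *
  generalize ξ (ρ * Real.cos (2 * π * s)) = x at *
  subst hsq
  ext
  · field_simp
  · field_simp
    ring

theorem contDiff_ovalCurve (h : IsRadialInv a ξ) (hρ : |ρ| < √(3 - a)) :
    ContDiff ℝ 1 (ovalCurve ξ ρ) := by
  have hd := h.hasDerivAt_ovalCurve hρ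
  have hmem := h.ovalCurve_fst_mem_Ioo hρ
  have hcont : Continuous (ovalCurve ξ ρ) :=
    continuous_iff_continuousAt.2 fun s => (hd s).continuousAt
  have hfst : Continuous fun s => (ovalCurve ξ ρ s).1 := continuous_fst.comp hcont
  have hfield : Continuous (hamField a) := by
    rw [funext (hamField_eq a)]
    fun_prop
  have hspeed : Continuous fun s => angularSpeed a (ovalCurve ξ ρ s) :=
    (continuous_const.mul hfst.sqrt).mul
      ((continuousOn_radialDeriv h.gt_neg_one h.lt_two).comp_continuous hfst
        fun s => Ioo_subset_Icc_self (hmem s))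
  refine contDiff_one_iff_deriv.2 ⟨fun s => (hd s).differentiableAt, ?_⟩
  rw [funext fun s => (hd s).deriv]
  exact (continuous_const.div hspeed fun s =>
    (angularSpeed_pos h.gt_neg_one h.lt_two (hmem s)).ne').smul (hfield.comp hcont)

theorem injOn_ovalCurve (h : IsRadialInv a ξ) (hρ : |ρ| < √(3 - a)) (hρ0 : ρ ≠ 0) :
    InjOn (ovalCurve ξ ρ) (Ico 0 1) := by
  intro s hs s' hs' hss'
  have hcirc := congrArg (circleCoord a) hss'
  rw [h.circleCoord_ovalCurve hρ, h.circleCoord_ovalCurve hρ] at hcirc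
  obtain ⟨hcos, hsin⟩ := Prod.ext_iff.1 hcirc
  obtain ⟨n, hn⟩ := Real.Angle.angle_eq_iff_two_pi_dvd_sub.1
    (angle_eq_of_mul_cos_eq_of_mul_sin_eq hρ0 hcos (neg_injective hsin))
  have hn' : s - s' = n := mul_left_cancel₀ Real.two_pi_pos.ne' (by rw [← hn]; ring)
  have hlt : (n : ℝ) < 1 := by linarith [hs.2, hs'.1]
  have hgt : (-1 : ℝ) < n := by linarith [hs.1, hs'.2]
  norm_cast at hlt hgt
  rw [show n = 0 by lia, Int.cast_zero] at hn'
  exact sub_eq_zero.1 hn'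

theorem mem_range_ovalCurve (h : IsRadialInv a ξ) (hρ : |ρ| < √(3 - a)) (hρ0 : 0 ≤ ρ)
    {p : ℝ × ℝ} (hp : p.1 ∈ Ioo 0 3) (hlevel : hamH a p.1 p.2 = ρ ^ 2 - 3 + a) :
    p ∈ range (ovalCurve ξ ρ) := by
  obtain ⟨θ, hu, hw⟩ := exists_angle_of_sq_add_sq_eq hρ0 (x := (circleCoord a p).1)
    (y := (circleCoord a p).2)
    (by rw [circleCoord_sq_add_sq h.gt_neg_one h.lt_two hp, hlevel]; ring)
  refine ⟨θ / (2 * π), injOn_circleCoord h.gt_neg_one h.lt_two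
    (h.ovalCurve_fst_mem_Ioo hρ _) hp ?_⟩
  rw [h.circleCoord_ovalCurve hρ, mul_div_cancel₀ _ Real.two_pi_pos.ne']
  exact Prod.ext hu.symm hw.symm

end IsRadialInv

/-- The region enclosed by the oval of `H = t`. -/
def ovalInterior (a t : ℝ) : Set (ℝ × ℝ) := {p | p.1 ∈ Ioo 0 3 ∧ hamH a p.1 p.2 < t}

theorem continuous_hamH (a : ℝ) : Continuous fun p : ℝ × ℝ => hamH a p.1 p.2 := by
  unfold hamH
  fun_prop

theorem isOpen_ovalInterior (a t : ℝ) : IsOpen (ovalInterior a t) :=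
  (isOpen_Ioo.preimage continuous_fst).inter (isOpen_lt (continuous_hamH a) continuous_const)

theorem isBounded_ovalInterior (ha : -1 < a) (ha' : a < 2) (ht : t ≤ 0) :
    Bornology.IsBounded (ovalInterior a t) := by
  refine ((Metric.isBounded_Icc (0 : ℝ) 3).prod (Metric.isBounded_Icc (-6 : ℝ) 6)).subset ?_
  rintro ⟨x, y⟩ ⟨hx : x ∈ Ioo 0 3, hH : hamH a x y < t⟩
  have hneg : y ^ 2 + a * x ^ 2 - 3 * (a - 1) * x + 3 * (a - 2) < 0 :=
    neg_of_mul_neg_right (hH.trans_le ht) hx.1.le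
  have hsq : y ^ 2 ≤ 6 ^ 2 := by nlinarith [hx.1, hx.2]
  exact ⟨Ioo_subset_Icc_self hx, abs_le.1 (abs_le_of_sq_le_sq hsq (by norm_num))⟩

theorem closure_ovalInterior_subset (ha : -1 < a) (ht : t < 0) :
    closure (ovalInterior a t) ⊆ {p | p.1 ∈ Ioo 0 3 ∧ hamH a p.1 p.2 ≤ t} := by
  have hclosed : IsClosed {p : ℝ × ℝ | p.1 ∈ Icc 0 3 ∧ hamH a p.1 p.2 ≤ t} :=
    (isClosed_Icc.preimage continuous_fst).inter
      (isClosed_le (continuous_hamH a) continuous_const)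
  intro p hp
  obtain ⟨⟨h0, h3⟩, hH⟩ := closure_minimal (t := {p : ℝ × ℝ | p.1 ∈ Icc 0 3 ∧ hamH a p.1 p.2 ≤ t})
    (fun p hp => ⟨Ioo_subset_Icc_self hp.1, hp.2.le⟩) hclosed hp
  refine ⟨⟨h0.lt_of_ne fun hp0 => ?_, h3.lt_of_ne fun hp3 => ?_⟩, hH⟩
  · rw [← hp0, hamH] at hH
    linarith
  · rw [hp3, hamH] at hH
    nlinarith [sq_nonneg p.2]

theorem IsRadialInv.isOval_ovalCurve (h : IsRadialInv a ξ) (ht : t ∈ Ioo (a - 3) 0) :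
    IsOval a t (ovalCurve ξ √(t + 3 - a)) := by
  have hpos : 0 < t + 3 - a := by linarith [ht.1]
  have hρ := abs_sqrt_add_sub_lt ht
  have hρ0 := Real.sqrt_pos.2 hpos
  have hlevel : √(t + 3 - a) ^ 2 - 3 + a = t := by rw [Real.sq_sqrt hpos.le]; ring
  have hcenter_lt : hamH a 1 0 < t := by rw [hamH]; linarith [ht.1]
  have hcenter : ((1, 0) : ℝ × ℝ) ∉ range (ovalCurve ξ √(t + 3 - a)) := by
    rintro ⟨s, hs⟩
    have := h.hamH_ovalCurve hρ s
    rw [hs, hlevel] at this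
    exact hcenter_lt.ne this
  refine ⟨h.contDiff_ovalCurve hρ, periodic_ovalCurve _ _, h.injOn_ovalCurve hρ hρ0.ne',
    fun s => (h.hamH_ovalCurve hρ s).trans hlevel, fun s => ⟨_, div_pos Real.two_pi_pos
      (angularSpeed_pos h.gt_neg_one h.lt_two (h.ovalCurve_fst_mem_Ioo hρ s)),
      (h.hasDerivAt_ovalCurve hρ s).deriv⟩, hcenter, ?_⟩
  refine (isBounded_ovalInterior h.gt_neg_one h.lt_two ht.2.le).subset <|
    isPreconnected_connectedComponentIn.subset_of_closure_inter_subset (isOpen_ovalInterior a t)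
      ⟨(1, 0), mem_connectedComponentIn hcenter, ⟨⟨one_pos, by norm_num⟩, hcenter_lt⟩⟩ ?_
  rintro p ⟨hp, hpc⟩
  obtain ⟨hmem, hle⟩ := closure_ovalInterior_subset h.gt_neg_one ht.2 hp
  refine ⟨hmem, hle.lt_of_ne fun heq => connectedComponentIn_subset _ _ hpc ?_⟩
  exact h.mem_range_ovalCurve hρ hρ0.le hmem (heq.trans hlevel.symm)

end OvalCurve

theorem exists_ovalIntegral_expansion {a r : ℝ} (ha : -1 < a) (ha' : a < 2)
    (hr : IsPFRadius ℝ a r) :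
    ∃ d : ℕ → Fin 3 → ℝ, VecSeriesConverges d r ∧ ∀ t ∈ Ioo (-r) 0, (∃ γ, IsOval a t γ) ∧
      ∀ γ, IsOval a t γ → ∀ k : Fin 3, ovalIntegral γ ((k : ℤ) - 1) =
        -2 * √(3 * (2 - a)) * vecSeries (holCoeff a) t k * Real.log |t| + vecSeries d t k := by
  obtain ⟨ξ, h⟩ := exists_isRadialInv ha ha'
  have hr3 : r ≤ 3 - a :=
    (hr.le_abs (ha'.trans (by norm_num)).ne).trans_eq (abs_of_pos (by linarith))
  obtain ⟨d, hd, hexpand⟩ := h.exists_abelInt_expansion hr hr3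
  refine ⟨d, hd, fun t ht => ?_⟩
  have ht' : t ∈ Ioo (a - 3) 0 := ⟨by linarith [ht.1], ht.2⟩
  refine ⟨⟨_, h.isOval_ovalCurve ht'⟩, fun γ hγ k => ?_⟩
  rw [h.ovalIntegral_eq_abelInt ht' hγ, hexpand t ht, Pi.add_apply, Pi.smul_apply, smul_eq_mul,
    Real.log_abs]
  ring

end

theorem lemma3 (a : ℝ) (ha1 : a ≠ -1) (ha2 : a ≠ 2) (ha3 : a ≠ 3) :
    ∃ (r : ℝ) (q : ℕ → Fin 3 → ℝ), 0 < r ∧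
      -- the power series `Q` and its first coefficients
      VecSeriesConverges q r ∧
      q 0 = ![1, 0, 0] ∧
      q 1 = -![(a - 1) / (12 * (a - 2) ^ 2), 1 / (6 * (a - 2)), 0] ∧
      q 2 = -![(11 * a ^ 2 - 22 * a + 15) / (576 * (a - 2) ^ 4),
              (a - 1) / (48 * (a - 2) ^ 3),
              1 / (72 * (a - 2) ^ 2)] ∧
      q 3 = -![35 * (a - 1) * (5 * a ^ 2 - 10 * a + 9) / (20736 * (a - 2) ^ 6),
              (85 * a ^ 2 - 170 * a + 105) / (10368 * (a - 2) ^ 5),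
              5 * (a - 1) / (864 * (a - 2) ^ 4)] ∧
      IsPFSolution a (Metric.ball (0 : ℂ) r) (vecSeries q) ∧
      -- the fundamental system near `t = 0`
      (a ≠ 0 → ∃ s : ℕ → Fin 3 → ℝ, VecSeriesConverges s r ∧
        -- for real `t < 0` and real `t > 0`, with `Real.log t = ln |t|`
        IsPFFundamental a (Set.Ioo (-r) 0) (logSystem a q s Real.log) ∧
        IsPFFundamental a (Set.Ioo 0 r) (logSystem a q s Real.log) ∧
        -- for complex `t`, with any branch `l` of the logarithm on any domain `U`
        ∀ (U : Set ℂ) (l : ℂ → ℂ), IsOpen U → IsConnected U →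
          U ⊆ Metric.ball 0 r \ {0} → ContinuousOn l U → (∀ t ∈ U, Complex.exp (l t) = t) →
          IsPFFundamental a U (logSystem a q s l)) ∧
      -- the expansions of `J_{-1}, J_0, J_1` near `t = -0`
      (-1 < a → a < 2 → ∃ d : ℕ → Fin 3 → ℝ, VecSeriesConverges d r ∧
        ∀ t : ℝ, -r < t → t < 0 →
          (∃ γ, IsOval a t γ) ∧
          ∀ γ, IsOval a t γ → ∀ i : Fin 3,
            ovalIntegral γ ((i : ℤ) - 1)
              = -2 * Real.sqrt (3 * (2 - a)) * vecSeries q t i * Real.log |t|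
                + vecSeries d t i) := by
  obtain ⟨r₁, h₁⟩ := exists_isPFRadius ℝ ha1 ha2 ha3
  obtain ⟨r₂, h₂⟩ := exists_isPFRadius ℂ ha1 ha2 ha3
  obtain ⟨r, hr⟩ : ∃ r, r = min r₁ r₂ := ⟨_, rfl⟩
  have hpos : 0 < r := hr ▸ lt_min h₁.pos h₂.pos
  have hreal : IsPFRadius ℝ a r := h₁.mono hpos (hr ▸ min_le_left _ _)
  have hcomplex : IsPFRadius ℂ a r := h₂.mono hpos (hr ▸ min_le_right _ _)
  refine ⟨r, holCoeff a, hpos, hreal.hol, rfl, holCoeff_one ha1 ha2 ha3, holCoeff_two ha1 ha2 ha3,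
    holCoeff_three ha1 ha2 ha3, (isPFCoeff_holCoeff ha1 ha2 ha3).isPFSolution hreal.hol,
    fun ha0 => ⟨logCoeff a, hreal.log, ?_, ?_, fun U l hUo hUc hU hl hexp => ?_⟩,
    fun ha ha' => ?_⟩
  · exact hreal.isPFFundamental_logSystem_real ha0 ha1 ha2 ha3 isOpen_Ioo
      (isConnected_Ioo (neg_lt_zero.2 hpos)) fun t ht =>
        ⟨by rw [mem_ball_zero_iff, Real.norm_of_nonpos ht.2.le]; exact neg_lt.1 ht.1, ht.2.ne⟩
  · exact hreal.isPFFundamental_logSystem_real ha0 ha1 ha2 ha3 isOpen_Ioo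
      (isConnected_Ioo hpos) fun t ht =>
        ⟨by rw [mem_ball_zero_iff, Real.norm_of_nonneg ht.1.le]; exact ht.2, ht.1.ne'⟩
  · exact hcomplex.isPFFundamental_logSystem_complex ha0 ha1 ha2 ha3 hUo hUc hU hl hexp
  · obtain ⟨d, hd, hexpand⟩ := exists_ovalIntegral_expansion ha ha' hreal
    refine ⟨d, hd, fun t hlt ht0 => ⟨(hexpand t ⟨hlt, ht0⟩).1, fun γ hγ i => ?_⟩⟩
    rw [(hexpand t ⟨hlt, ht0⟩).2 γ hγ i]
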